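/- Let $G$ be a compact Lie group with Lie algebra $\mathfrak g$, let $(\cdot,\cdot)$ be an $\mathrm{Ad}(G)$-invariant inner product on $\mathfrak g$, and let $M=G/H$ be a homogeneous $G$-space, i.e. a smooth manifold with a smooth transitive $G$-action, where $H$ is the isotropy group of a point $o\in M$. Let $\mathfrak h$ be the Lie algebra of $H$, let $\mathfrak m=\mathfrak h^{\perp}$, and let $\varphi_o:G\to M$, $b\mapsto b\cdot o$. For a $G$-invariant Riemannian metric $g$ on $M$, the metric operator of $g$ is the unique linear map $A:\mathfrak m\to\mathfrak m$ with $(AX,Y)=g_o\big((d\varphi_o)_eX,(d\varphi_o)_eY\big)$ for all $X,Y\in\mathfrak m$. Let $\mathfrak m=\mathfrak m_1\oplus\cdots\oplus\mathfrak m_s$ be a decomposition into $\mathrm{Ad}(H)$-invariant, irreducible, pairwise orthogonal subspaces. Let $C_1,\dots,C_S$ be the classes of the relation "$\mathfrak m_p$ and $\mathfrak m_q$ are equivalent representations of $H$" on $\{1,\dots,s\}$, and let $M_i=\bigoplus_{j\in C_i}\mathfrak m_j$ be the isotypical summands. For each $i$ write $C_i=\{j_1,\dots,j_t\}$ and $d_i=\dim\mathfrak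 m_{j_1}$ (the $j_k$ and $t$ depend on $i$). Call a $d\times d$ real matrix a *scalar block* of real, complex or quaternionic type if it is block diagonal of the form $\mathrm{diag}(\zeta,\dots,\zeta)$ with, respectively, $$\zeta=a,\qquad \zeta=\begin{pmatrix}a&-b\\ b&a\end{pmatrix},\qquad \zeta=\begin{pmatrix}a&d'&-b&-c\\-d'&a&c&-b\\ b&-c&a&-d'\\ c&b&d'&a\end{pmatrix}\qquad(a,b,c,d'\in\mathbb R).$$ Let $\mathcal B$ be an orthonormal basis of $\mathfrak m$ adapted to $\mathfrak m=M_1\oplus\cdots\oplus M_S$. This means that, for each $i$, there are an orthonormal basis $\mathcal B_{j_1}$ of $\mathfrak m_{j_1}$ in which the matrices of the $\mathrm{Ad}(H)$-equivariant endomorphisms of $\mathfrak m_{j_1}$ are exactly all scalar blocks of one of the three types, and $\mathrm{Ad}(H)$-equivariant linear isometries $T_{j_1}^{j_k}:\mathfrak m_{j_1}\to\mathfrak m_{j_k}$ with $T_{j_1}^{j_1}=\mathrm{id}$, such that $\mathcal B$ consists of the bases $T_{j_1}^{j_1}(\mathcal B_{j_1}),\dots,T_{j_1}^{j_t}(\mathcal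 B_{j_1})$ for $i=1,\dots,S$, in this order. Consider matrices of the form $$\begin{pmatrix}A_1&&0\\&\ddots&\\0&&A_S\end{pmatrix},\qquad A_i=\begin{pmatrix}\mu_{j_1}\mathrm I_{d_i}&(A^i_{21})^T&\cdots&(A^i_{t1})^T\\ A^i_{21}&\mu_{j_2}\mathrm I_{d_i}&\cdots&(A^i_{t2})^T\\ \vdots&\vdots&\ddots&\vdots\\ A^i_{t1}&A^i_{t2}&\cdots&\mu_{j_t}\mathrm I_{d_i}\end{pmatrix},\tag{$*$}$$ where $\mu_{j_1},\dots,\mu_{j_t}>0$ and each $A^i_{lk}$ ($l>k$) is a $d_i\times d_i$ scalar block of real, complex or quaternionic type. (1) For every $G$-invariant metric $g$ on $M$, the matrix $[A]_{\mathcal B}$ of its metric operator $A$ has the form $(*)$. (2) Conversely, if a matrix of the form $(*)$ is positive definite and $A^i_{lk}\,[\mathrm{Ad}(h)|_{\mathfrak m_{j_1}}]_{\mathcal B_{j_1}}=[\mathrm{Ad}(h)|_{\mathfrak m_{j_1}}]_{\mathcal B_{j_1}}\,A^i_{lk}$ for all $h\in H$, all $i$ and all $l>k$, then the operator $A:\mathfrak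 m\to\mathfrak m$ with this matrix in the basis $\mathcal B$ is the metric operator of some $G$-invariant metric $g$ on $M$. -/

import Mathlib

open scoped Manifold ContDiff

noncomputable section

namespace InvMetric

section LieGroup

variable {E : Type*} [NormedAddCommGroup E] [NormedSpace ℝ E]
  {HG : Type*} [TopologicalSpace HG] (I : ModelWithCorners ℝ E HG)
  {G : Type*} [TopologicalSpace G] [ChartedSpace HG G] [Group G]

/-- The differential at the identity of the conjugation `b ↦ a * b * a⁻¹`. It takes values in the
tangent space at `a * 1 * a⁻¹ = 1`. -/
def adjoint (a : G) : GroupLieAlgebra I G →ₗ[ℝ] GroupLieAlgebra I G :=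
  ((mfderiv I I (fun b : G => a * b * a⁻¹) 1 :
    GroupLieAlgebra I G →L[ℝ] TangentSpace I (a * 1 * a⁻¹)) :
      GroupLieAlgebra I G →ₗ[ℝ] TangentSpace I (a * 1 * a⁻¹))

theorem adjoint_one : adjoint I (1 : G) = 1 := by
  have h : (fun b : G => 1 * b * 1⁻¹) = id := by funext b; simp
  apply LinearMap.ext
  intro X
  change (mfderiv I I (fun b : G => 1 * b * 1⁻¹) 1) X = X
  rw [h, mfderiv_id]
  rfl

theorem adjoint_mul [LieGroup I ∞ G] (a b : G) :
    adjoint I (a * b) = adjoint I a * adjoint I b := by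
  have hd : ∀ (c x : G), MDifferentiableAt I I (fun y : G => c * y * c⁻¹) x := fun c x =>
    (((contMDiff_mul_left (I := I) (n := ∞) (a := c)).mul
      (contMDiff_const (c := c⁻¹))).mdifferentiable (by simp)) x
  have h : (fun y : G => a * b * y * (a * b)⁻¹) =
      (fun y => a * y * a⁻¹) ∘ (fun y => b * y * b⁻¹) := by
    funext y; simp [mul_assoc]
  have h1 : b * 1 * b⁻¹ = 1 := by simp
  apply LinearMap.ext
  intro X
  have key := mfderiv_comp_apply_of_eq (I := I) (I' := I) (I'' := I) (x := (1 : G))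
    (hd a 1) (hd b 1) h1 X
  change (mfderiv I I (fun y : G => a * b * y * (a * b)⁻¹) 1) X = _
  rw [h]
  exact key

/-- The adjoint representation `Ad` of a Lie group on its Lie algebra. -/
def Ad [LieGroup I ∞ G] : Representation ℝ G (GroupLieAlgebra I G) where
  toFun := adjoint I
  map_one' := adjoint_one I
  map_mul' := adjoint_mul I

/-- The Lie algebra of a closed subgroup `K` of `G`: all initial velocities of one-parameter
subgroups of `G` that stay in `K`, i.e. `{X | exp (tX) ∈ K for all t}`. (A differentiable
homomorphism `ℝ → G` is automatically smooth.) -/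
def lieAlgebraOf (K : Subgroup G) : Set (GroupLieAlgebra I G) :=
  {X | ∃ γ : ℝ → G, MDifferentiable 𝓘(ℝ, ℝ) I γ ∧ (∀ s t, γ (s + t) = γ s * γ t) ∧
    (∀ t, γ t ∈ K) ∧ (mfderiv 𝓘(ℝ, ℝ) I γ 0 : ℝ →L[ℝ] GroupLieAlgebra I G) 1 = X}

/-- `B` is an `Ad(G)`-invariant inner product on the Lie algebra of `G`. -/
structure IsInvariantInner [LieGroup I ∞ G] (B : LinearMap.BilinForm ℝ (GroupLieAlgebra I G)) :
    Prop where
  symm : ∀ X Y, B X Y = B Y X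
  pos : ∀ X, X ≠ 0 → 0 < B X X
  invariant : ∀ (a : G) (X Y), B (Ad I a X) (Ad I a Y) = B X Y

/-- The `B`-orthogonal complement of the Lie algebra of `K`. -/
def complement (B : LinearMap.BilinForm ℝ (GroupLieAlgebra I G)) (K : Subgroup G) :
    Submodule ℝ (GroupLieAlgebra I G) where
  carrier := {X | ∀ Y ∈ lieAlgebraOf I K, B X Y = 0}
  add_mem' := by
    intro X X' hX hX' Y hY
    simp [hX Y hY, hX' Y hY]
  zero_mem' := by
    intro Y _
    simp
  smul_mem' := by
    intro c X hX Y hY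
    simp [hX Y hY]

end LieGroup

section Homogeneous

variable {E : Type*} [NormedAddCommGroup E] [NormedSpace ℝ E]
  {HG : Type*} [TopologicalSpace HG] (I : ModelWithCorners ℝ E HG)
  {G : Type*} [TopologicalSpace G] [ChartedSpace HG G] [Group G]
  {F : Type*} [NormedAddCommGroup F] [NormedSpace ℝ F]
  {HM : Type*} [TopologicalSpace HM] (J : ModelWithCorners ℝ F HM)
  {M : Type*} [TopologicalSpace M] [ChartedSpace HM M] [MulAction G M]

/-- The restriction to the isotropy group `H` of `o` of the adjoint representation of `G`. -/
def AdH [LieGroup I ∞ G] (o : M) :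
    Representation ℝ (MulAction.stabilizer G o) (GroupLieAlgebra I G) :=
  (Ad I).comp (MulAction.stabilizer G o).subtype

/-- Smooth Riemannian metrics on `M`. -/
abbrev SmoothMetric (M : Type*) [TopologicalSpace M] [ChartedSpace HM M] [IsManifold J ∞ M] :=
  Bundle.ContMDiffRiemannianMetric J ∞ F (fun x : M => TangentSpace J x)

/-- Every `a : G` acts on `(M, g)` by an isometry. -/
def IsInvariantMetric [IsManifold J ∞ M] (G : Type*) [Group G] [MulAction G M]
    (g : SmoothMetric J M) : Prop :=
  ∀ (a : G) (x : M) (v w : TangentSpace J x),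
    g.inner (a • x) (mfderiv J J (fun y : M => a • y) x v) (mfderiv J J (fun y : M => a • y) x w)
      = g.inner x v w

/-- The differential at the identity of the orbit map `b ↦ b • o`. It takes values in the tangent
space at `1 • o = o`. -/
def orbitDeriv (o : M) : GroupLieAlgebra I G →L[ℝ] TangentSpace J o :=
  (mfderiv I J (fun b : G => b • o) 1 : GroupLieAlgebra I G →L[ℝ] TangentSpace J ((1 : G) • o))

/-- `A : 𝔪 → 𝔪` is the metric operator of `g`: one has `B (A X) Y = ⟨X, Y⟩_g`, where `⟨·,·⟩_g` is
the pullback of `g_o` under the differential of the orbit map. -/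
def IsMetricOperator [IsManifold J ∞ M] (o : M) (B : LinearMap.BilinForm ℝ (GroupLieAlgebra I G))
    (𝔪 : Submodule ℝ (GroupLieAlgebra I G)) (g : SmoothMetric J M) (A : 𝔪 →ₗ[ℝ] 𝔪) : Prop :=
  ∀ X Y : 𝔪, B (A X : GroupLieAlgebra I G) (Y : GroupLieAlgebra I G) =
    g.inner o (orbitDeriv I J o (X : GroupLieAlgebra I G))
      (orbitDeriv I J o (Y : GroupLieAlgebra I G))

end Homogeneous

section Matrices

/-- The three types of irreducible real representations. -/
inductive ScalarType
  | real
  | complex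
  | quaternion

/-- The block-diagonal `d × d` matrix `diag(ζ, …, ζ)` with consecutive `r × r` blocks. -/
def repeatDiag {r : ℕ} [NeZero r] (d : ℕ) (ζ : Matrix (Fin r) (Fin r) ℝ) :
    Matrix (Fin d) (Fin d) ℝ :=
  Matrix.of fun p q =>
    if (p : ℕ) / r = (q : ℕ) / r then ζ (Fin.ofNat r p) (Fin.ofNat r q) else 0

/-- `N = diag(ζ, …, ζ)`, where `ζ` is a real number, the `2 × 2` real matrix of a complex number or
the `4 × 4` real matrix of a quaternion, according to the type. -/
def IsScalarBlock {d : ℕ} (N : Matrix (Fin d) (Fin d) ℝ) : ScalarType → Prop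
  | .real => ∃ a : ℝ, N = repeatDiag d !![a]
  | .complex => 2 ∣ d ∧ ∃ a b : ℝ, N = repeatDiag d !![a, -b; b, a]
  | .quaternion => 4 ∣ d ∧ ∃ a b c e : ℝ,
      N = repeatDiag d !![a, e, -b, -c; -e, a, c, -b; b, -c, a, -e; c, b, e, a]

/-- The basis `β` of the representation space is in normal form: for one of the three types, the
matrices in `β` of the equivariant endomorphisms are exactly the matrices `diag(ζ, …, ζ)` of that
type. -/
def IsNormalBasis {K V : Type*} [Monoid K] [AddCommGroup V] [Module ℝ V]
    (ρ : Representation ℝ K V) {d : ℕ} (β : Module.Basis (Fin d) ℝ V) : Prop :=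
  ∃ τ : ScalarType, ∀ N : Matrix (Fin d) (Fin d) ℝ,
    (∃ S : ρ.IntertwiningMap ρ, LinearMap.toMatrix β β S.toLinearMap = N) ↔ IsScalarBlock N τ

/-- The symmetric-shaped `t × t` block matrix with diagonal blocks `μ l • 1`, with blocks `N l k`
below the diagonal, and with the transposes `(N k l)ᵀ` above the diagonal. -/
def isotypicalBlock {t d : ℕ} (μ : Fin t → ℝ) (N : Fin t → Fin t → Matrix (Fin d) (Fin d) ℝ) :
    Matrix (Fin t × Fin d) (Fin t × Fin d) ℝ :=
  Matrix.of fun x y =>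
    if x.1 = y.1 then (μ x.1 • (1 : Matrix (Fin d) (Fin d) ℝ)) x.2 y.2
    else if y.1 < x.1 then N x.1 y.1 x.2 y.2
    else (N y.1 x.1).transpose x.2 y.2

end Matrices

section Decomposition

variable {K V : Type*} [Group K] [AddCommGroup V] [Module ℝ V] {ρ : Representation ℝ K V}

/-- `𝔪 = 𝔪₁ ⊕ ⋯ ⊕ 𝔪ₛ` with invariant, irreducible, pairwise `B`-orthogonal subspaces (for an inner
product `B`, orthogonality makes the sum direct). -/
structure IsDecomposition (B : LinearMap.BilinForm ℝ V) (𝔪 : Submodule ℝ V) {s : ℕ}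
    (W : Fin s → Subrepresentation ρ) : Prop where
  irreducible : ∀ j, (W j).toRepresentation.IsIrreducible
  orthogonal : ∀ p q, p ≠ q → ∀ X ∈ W p, ∀ Y ∈ W q, B X Y = 0
  iSup_eq : ⨆ j, (W j).toSubmodule = 𝔪

/-- The index set `{1, …, s}` is partitioned into the classes `C i = {e ⟨i, 0⟩, e ⟨i, 1⟩, …}` of
equivalent summands. The `i`-th isotypical summand is the sum of the `W (e ⟨i, k⟩)` over `k`. -/
def IsIsotypical {s : ℕ} (W : Fin s → Subrepresentation ρ) {S : ℕ} {t : Fin S → ℕ}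
    (e : (Σ i, Fin (t i)) ≃ Fin s) : Prop :=
  ∀ x y, Nonempty ((W (e x)).toRepresentation.Equiv (W (e y)).toRepresentation) ↔ x.1 = y.1

/-- A `B`-orthonormal basis of `𝔪` adapted to the isotypical decomposition: in each class `i` an
orthonormal basis in normal form of the first summand is chosen, and it is transported to the other
summands of the class by equivariant isometries. -/
structure AdaptedBasis (B : LinearMap.BilinForm ℝ V) (𝔪 : Submodule ℝ V) {s : ℕ}
    (W : Fin s → Subrepresentation ρ) {S : ℕ} {t : Fin S → ℕ} [∀ i, NeZero (t i)]
    (e : (Σ i, Fin (t i)) ≃ Fin s) where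
  /-- The dimension of the summands in the class `i`. -/
  d : Fin S → ℕ
  /-- The basis of the first summand of the class `i`. -/
  first (i : Fin S) : Module.Basis (Fin (d i)) ℝ (W (e ⟨i, 0⟩)).toSubmodule
  first_orthonormal : ∀ i p q, B (first i p) (first i q) = if p = q then 1 else 0
  first_normal : ∀ i, IsNormalBasis (W (e ⟨i, 0⟩)).toRepresentation (first i)
  /-- The equivariant isomorphism from the first to the `k`-th summand of the class `i`. -/
  T (i : Fin S) (k : Fin (t i)) :
    (W (e ⟨i, 0⟩)).toRepresentation.Equiv (W (e ⟨i, k⟩)).toRepresentation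
  T_zero : ∀ i X, T i 0 X = X
  T_isometry : ∀ i k X Y, B (T i k X) (T i k Y) = B X Y
  /-- The resulting basis of `𝔪`. -/
  basis : Module.Basis (Σ i, Fin (t i) × Fin (d i)) ℝ 𝔪
  basis_apply : ∀ i k p, (basis ⟨i, (k, p)⟩ : V) = T i k (first i p)

end Decomposition

end InvMetric

end

open scoped Manifold ContDiff
open InvMetric

/-!
The metric operator represents the pullback of `g_o` to `𝔪` along the differential of the orbit map.
That differential intertwines `Ad(H)` with the isotropy representation (`orbitDeriv_AdH`), so for an
invariant metric the pullback is an `Ad(H)`-invariant symmetric form; it is positive definite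
because the kernel of the differential is exactly the Lie algebra of `H`
(`mem_lieAlgebraOf_stabilizer`: if `X` is in the kernel, the one-parameter subgroup of `X` fixes
`o`). The rest of the direct part is linear algebra (`AdaptedBasis.exists_toMatrix_eq`). An
invariant form pairing two summands is represented by an equivariant map between them, so by Schur's
lemma it vanishes on inequivalent summands, and on equivalent ones, after transport by the
isometries `T`, its matrix is a scalar block. A diagonal block is moreover symmetric, and a
symmetric scalar block is a multiple of the identity (`IsScalarBlock.eq_smul_one`).

For the converse, the blocks below the diagonal commute with the matrices of `Ad(h)`, which are
orthogonal; hence so do their transposes, and the operator is equivariant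
(`AdaptedBasis.toLin_comm`). As `𝔪` is isomorphic to the tangent space at `o`
(`orbitDeriv_complement_bijective`), the operator defines an inner product there that is invariant
under the isotropy group, and moving it around by the action gives a well-defined invariant metric.
Smoothness of that metric needs smooth local sections of the orbit map, so the orbit map has to be a
submersion (`orbitDeriv_surjective`). If it were not, the orbit of `o` would locally be the smooth
image of a slice transverse to `H`, of dimension less than `dim M` (`exists_slice`). By compactness
`M` would be a finite union of translates of a compact subset of that image, whose complement is
dense by a Hausdorff dimension count, contradicting Baire's theorem.
-/

open scoped Manifold ContDiff

/-! ### Invariant bilinear forms and Schur's lemma -/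

section Algebra

open InvMetric

namespace InvMetric

/-- Vectors are determined by their inner products. -/
theorem injective_of_pos {V : Type*} [AddCommGroup V] [Module ℝ V] {b : LinearMap.BilinForm ℝ V}
    (hpos : ∀ X, X ≠ 0 → 0 < b X X) : Function.Injective b := by
  rw [injective_iff_map_eq_zero]
  intro X hX
  by_contra h
  have := hpos X h
  simp [hX] at this

/-- Every bilinear form is represented by a linear map through an inner product. -/
theorem exists_linearMap_of_pos {U V : Type*} [AddCommGroup U] [Module ℝ U] [AddCommGroup V]
    [Module ℝ V] [FiniteDimensional ℝ V] {b : LinearMap.BilinForm ℝ V}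
    (hpos : ∀ X, X ≠ 0 → 0 < b X X) (Q : U →ₗ[ℝ] V →ₗ[ℝ] ℝ) :
    ∃ f : U →ₗ[ℝ] V, ∀ X Y, b (f X) Y = Q X Y := by
  have hb := injective_of_pos hpos
  let e : V ≃ₗ[ℝ] (V →ₗ[ℝ] ℝ) := LinearEquiv.ofBijective b
    ⟨hb, (LinearMap.injective_iff_surjective_of_finrank_eq_finrank
      (f := b) (Subspace.dual_finrank_eq (K := ℝ) (V := V)).symm).1 hb⟩
  exact ⟨e.symm.toLinearMap ∘ₗ Q, fun X Y => LinearMap.congr_fun (e.apply_symm_apply (Q X)) Y⟩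

/-- A bilinear form between two representations that is invariant under the group is represented,
through an invariant inner product on the second one, by an intertwining map. -/
theorem exists_intertwiningMap_of_invariant {K U V : Type*} [Group K]
    [AddCommGroup U] [Module ℝ U] [AddCommGroup V] [Module ℝ V] [FiniteDimensional ℝ V]
    (ρ : Representation ℝ K U) (σ : Representation ℝ K V)
    (b : LinearMap.BilinForm ℝ V) (hpos : ∀ X, X ≠ 0 → 0 < b X X)
    (hinv : ∀ h X Y, b (σ h X) (σ h Y) = b X Y)
    (Q : U →ₗ[ℝ] V →ₗ[ℝ] ℝ) (hQ : ∀ h X Y, Q (ρ h X) (σ h Y) = Q X Y) :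
    ∃ f : ρ.IntertwiningMap σ, ∀ X Y, b (f X) Y = Q X Y := by
  obtain ⟨f, hf⟩ := exists_linearMap_of_pos hpos Q
  refine ⟨⟨f, ?_⟩, hf⟩
  intro h
  ext1 X
  apply injective_of_pos hpos
  ext Y
  have h1 := hinv h (f X) (σ h⁻¹ Y)
  have h2 : σ h (σ h⁻¹ Y) = Y := by simp
  rw [h2, hf, ← hQ h, h2] at h1
  simpa [hf] using h1.symm

variable {K V : Type*} [Group K] [AddCommGroup V] [Module ℝ V]
  {ρ : Representation ℝ K V} {B : LinearMap.BilinForm ℝ V}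

theorem exists_intertwiningMap_subrepresentation [FiniteDimensional ℝ V]
    (hpos : ∀ X, X ≠ 0 → 0 < B X X) (hinv : ∀ h X Y, B (ρ h X) (ρ h Y) = B X Y)
    {U : Type*} [AddCommGroup U] [Module ℝ U] (σ : Representation ℝ K U) (W : Subrepresentation ρ)
    (Q : U →ₗ[ℝ] W.toSubmodule →ₗ[ℝ] ℝ) (hQ : ∀ h X Y, Q (σ h X) (W.toRepresentation h Y) = Q X Y) :
    ∃ f : σ.IntertwiningMap W.toRepresentation, ∀ X (Y : W.toSubmodule), B (f X) Y = Q X Y :=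
  exists_intertwiningMap_of_invariant σ W.toRepresentation
    (B.compl₁₂ W.toSubmodule.subtype W.toSubmodule.subtype)
    (fun X hX => hpos X (by simpa using hX)) (fun h X Y => hinv h X Y) Q hQ

/-- An invariant bilinear form vanishes between inequivalent irreducible subrepresentations. -/
theorem invariant_eq_zero_of_not_equiv [FiniteDimensional ℝ V]
    (hpos : ∀ X, X ≠ 0 → 0 < B X X) (hinv : ∀ h X Y, B (ρ h X) (ρ h Y) = B X Y)
    (Q : LinearMap.BilinForm ℝ V) (hQ : ∀ h X Y, Q (ρ h X) (ρ h Y) = Q X Y)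
    (W W' : Subrepresentation ρ) (hW : W.toRepresentation.IsIrreducible)
    (hW' : W'.toRepresentation.IsIrreducible)
    (hne : ¬ Nonempty (W.toRepresentation.Equiv W'.toRepresentation))
    {X Y : V} (hX : X ∈ W.toSubmodule) (hY : Y ∈ W'.toSubmodule) : Q X Y = 0 := by
  obtain ⟨f, hf⟩ := exists_intertwiningMap_subrepresentation hpos hinv W.toRepresentation W'
    (Q.compl₁₂ W.toSubmodule.subtype W'.toSubmodule.subtype) (fun h X Y => hQ h X Y)
  have hf0 : f = 0 := (Representation.IsIrreducible.bijective_or_eq_zero f).resolve_left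
    fun h => hne ⟨f.ofBijective h⟩
  have := hf ⟨X, hX⟩ ⟨Y, hY⟩
  rw [hf0] at this
  simpa using this.symm

/-- A symmetric matrix that is a scalar block is a multiple of the identity: the imaginary parts
of `ζ` sit skew-symmetrically. -/
theorem IsScalarBlock.eq_smul_one {d : ℕ} {N : Matrix (Fin d) (Fin d) ℝ} {τ : ScalarType}
    (hN : IsScalarBlock N τ) (hsymm : N.transpose = N) : ∃ a : ℝ, N = a • 1 := by
  rcases Nat.eq_zero_or_pos d with rfl | hd
  · exact ⟨0, by ext i; exact i.elim0⟩
  have entry : ∀ i j, N i j = N j i := fun i j => congrFun (congrFun hsymm j) i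
  -- repeating a scalar `r × r` block gives a scalar matrix, even if `r` does not divide `d`
  have key : ∀ {r : ℕ} [NeZero r] (a : ℝ),
      repeatDiag (r := r) d (a • 1) = (a • 1 : Matrix (Fin d) (Fin d) ℝ) := by
    intro r _ a
    ext p q
    simp only [repeatDiag, Matrix.of_apply, Matrix.smul_apply, Matrix.one_apply]
    rcases eq_or_ne p q with rfl | hpq
    · simp
    · rw [if_neg hpq]
      split_ifs with h1 h2
      · exfalso
        apply hpq
        have h3 : (p : ℕ) % r = q % r := by
          simpa [Fin.ofNat, Fin.ext_iff] using h2
        ext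
        rw [← Nat.div_add_mod (p : ℕ) r, ← Nat.div_add_mod (q : ℕ) r, h1, h3]
      · simp
      · simp
  cases τ with
  | real =>
    obtain ⟨a, rfl⟩ := hN
    refine ⟨a, ?_⟩
    rw [← key (r := 1)]
    congr 1
    ext i j
    fin_cases i; fin_cases j; simp
  | complex =>
    obtain ⟨h2, a, b, rfl⟩ := hN
    have hd2 : 2 ≤ d := Nat.le_of_dvd hd h2
    have h01 := entry ⟨0, by omega⟩ ⟨1, by omega⟩
    simp [repeatDiag, Fin.ofNat] at h01
    have hb : b = 0 := by linarith
    refine ⟨a, ?_⟩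
    rw [← key (r := 2)]
    congr 1
    ext i j
    fin_cases i <;> fin_cases j <;> simp [hb]
  | quaternion =>
    obtain ⟨h4, a, b, c, e, rfl⟩ := hN
    have hd4 : 4 ≤ d := Nat.le_of_dvd hd h4
    have h01 := entry ⟨0, by omega⟩ ⟨1, by omega⟩
    have h02 := entry ⟨0, by omega⟩ ⟨2, by omega⟩
    have h03 := entry ⟨0, by omega⟩ ⟨3, by omega⟩
    simp [repeatDiag, Fin.ofNat] at h01 h02 h03
    have hb : b = 0 := by linarith
    have hc : c = 0 := by linarith
    have he : e = 0 := by linarith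
    refine ⟨a, ?_⟩
    rw [← key (r := 4)]
    congr 1
    ext i j
    fin_cases i <;> fin_cases j <;> simp [hb, hc, he]

/-! ### The matrix of an equivariant operator in an adapted basis -/

section AdaptedBasis

variable {𝔪 : Submodule ℝ V} {s : ℕ} {W : Fin s → Subrepresentation ρ} {S : ℕ} {t : Fin S → ℕ}
  [∀ i, NeZero (t i)] {e : (Σ i, Fin (t i)) ≃ Fin s}

/-- In an orthonormal basis the coordinates are inner products with the basis vectors. -/
theorem repr_eq_of_orthonormal {U : Submodule ℝ V} {ι : Type*} [Fintype ι] [DecidableEq ι]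
    (b : Module.Basis ι ℝ U) (hb : ∀ i j, B (b i) (b j) = if i = j then 1 else 0) (X : U) (i : ι) :
    b.repr X i = B X (b i) := by
  have h := congrArg (fun Z : U => B (Z : V) (b i)) (b.sum_repr X)
  simp only [Submodule.coe_sum, Submodule.coe_smul, map_sum, LinearMap.sum_apply, map_smul,
    LinearMap.smul_apply, hb] at h
  rw [← h]
  simp

theorem AdaptedBasis.T_apply (𝓑 : AdaptedBasis B 𝔪 W e) (i : Fin S) (k : Fin (t i)) (h : K)
    (X : (W (e ⟨i, 0⟩)).toSubmodule) :
    (𝓑.T i k ((W (e ⟨i, 0⟩)).toRepresentation h X) : V) = ρ h (𝓑.T i k X) :=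
  congrArg Subtype.val (LinearMap.congr_fun ((𝓑.T i k).isIntertwining' h) X)

theorem AdaptedBasis.basis_mem (𝓑 : AdaptedBasis B 𝔪 W e) (i : Fin S) (k : Fin (t i))
    (p : Fin (𝓑.d i)) : (𝓑.basis ⟨i, (k, p)⟩ : V) ∈ (W (e ⟨i, k⟩)).toSubmodule := by
  rw [𝓑.basis_apply]
  exact Subtype.property _

theorem AdaptedBasis.orthonormal (𝓑 : AdaptedBasis B 𝔪 W e) (hW : IsDecomposition B 𝔪 W)
    (x y : Σ i, Fin (t i) × Fin (𝓑.d i)) :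
    B (𝓑.basis x) (𝓑.basis y) = if x = y then 1 else 0 := by
  obtain ⟨i, k, p⟩ := x
  obtain ⟨j, l, q⟩ := y
  by_cases h : (⟨i, k⟩ : Σ i, Fin (t i)) = ⟨j, l⟩
  · obtain ⟨rfl, h⟩ := Sigma.mk.inj_iff.1 h
    obtain rfl := eq_of_heq h
    rw [𝓑.basis_apply, 𝓑.basis_apply, 𝓑.T_isometry, 𝓑.first_orthonormal]
    simp
  · rw [hW.orthogonal _ _ (e.injective.ne h) _ (𝓑.basis_mem i k p) _ (𝓑.basis_mem j l q),
      if_neg]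
    rintro hh
    apply h
    have := congrArg (fun z : Σ i, Fin (t i) × Fin (𝓑.d i) => (⟨z.1, z.2.1⟩ : Σ i, Fin (t i))) hh
    exact this

theorem AdaptedBasis.repr_eq (𝓑 : AdaptedBasis B 𝔪 W e) (hW : IsDecomposition B 𝔪 W) (X : 𝔪)
    (x : Σ i, Fin (t i) × Fin (𝓑.d i)) : 𝓑.basis.repr X x = B X (𝓑.basis x) :=
  repr_eq_of_orthonormal 𝓑.basis (𝓑.orthonormal hW) X x

theorem AdaptedBasis.toMatrix_apply (𝓑 : AdaptedBasis B 𝔪 W e) (hW : IsDecomposition B 𝔪 W)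
    (A : 𝔪 →ₗ[ℝ] 𝔪) (x y : Σ i, Fin (t i) × Fin (𝓑.d i)) :
    LinearMap.toMatrix 𝓑.basis 𝓑.basis A x y = B (A (𝓑.basis y)) (𝓑.basis x) := by
  rw [LinearMap.toMatrix_apply, 𝓑.repr_eq hW]

theorem AdaptedBasis.inner_toLin (𝓑 : AdaptedBasis B 𝔪 W e) (hW : IsDecomposition B 𝔪 W)
    (D : Matrix (Σ i, Fin (t i) × Fin (𝓑.d i)) (Σ i, Fin (t i) × Fin (𝓑.d i)) ℝ) (X Y : 𝔪) :
    B (Matrix.toLin 𝓑.basis 𝓑.basis D X) Y =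
      𝓑.basis.repr Y ⬝ᵥ D.mulVec (𝓑.basis.repr X) := by
  conv_lhs => rw [← 𝓑.basis.sum_repr Y]
  simp only [Submodule.coe_sum, Submodule.coe_smul, map_sum, map_smul, smul_eq_mul, dotProduct]
  refine Finset.sum_congr rfl fun x _ => ?_
  rw [← 𝓑.repr_eq hW, Matrix.repr_toLin]

/-- The blocks of an invariant form within an isotypical summand are scalar blocks, by
transport to the first summand of the class. -/
theorem AdaptedBasis.isScalarBlock_of_invariant [FiniteDimensional ℝ V]
    (𝓑 : AdaptedBasis B 𝔪 W e)
    (hpos : ∀ X, X ≠ 0 → 0 < B X X) (hinv : ∀ h X Y, B (ρ h X) (ρ h Y) = B X Y)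
    (Q : LinearMap.BilinForm ℝ V) (hQ : ∀ h X Y, Q (ρ h X) (ρ h Y) = Q X Y)
    (i : Fin S) (l k : Fin (t i)) : ∃ τ, IsScalarBlock
      (Matrix.of fun p q => Q (𝓑.basis ⟨i, (k, q)⟩) (𝓑.basis ⟨i, (l, p)⟩)) τ := by
  obtain ⟨τ, hτ⟩ := 𝓑.first_normal i
  refine ⟨τ, (hτ _).1 ?_⟩
  obtain ⟨f, hf⟩ := exists_intertwiningMap_subrepresentation hpos hinv
    (W (e ⟨i, 0⟩)).toRepresentation (W (e ⟨i, 0⟩))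
    (Q.compl₁₂ ((W (e ⟨i, k⟩)).toSubmodule.subtype ∘ₗ (𝓑.T i k).toLinearMap)
      ((W (e ⟨i, l⟩)).toSubmodule.subtype ∘ₗ (𝓑.T i l).toLinearMap)) (by
      intro h X Y
      change Q (𝓑.T i k _ : V) (𝓑.T i l _ : V) = Q (𝓑.T i k _ : V) (𝓑.T i l _ : V)
      rw [𝓑.T_apply, 𝓑.T_apply, hQ])
  refine ⟨f, ?_⟩
  ext p q
  rw [LinearMap.toMatrix_apply, Matrix.of_apply, 𝓑.basis_apply, 𝓑.basis_apply]
  rw [repr_eq_of_orthonormal (B := B) _ (𝓑.first_orthonormal i)]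
  exact hf _ _

/-- The Gram matrix of an invariant symmetric form that is positive on `𝔪`, in an adapted basis. -/
theorem AdaptedBasis.exists_toMatrix_eq [FiniteDimensional ℝ V]
    (𝓑 : AdaptedBasis B 𝔪 W e) (hW : IsDecomposition B 𝔪 W)
    (he : IsIsotypical W e)
    (hpos : ∀ X, X ≠ 0 → 0 < B X X) (hinv : ∀ h X Y, B (ρ h X) (ρ h Y) = B X Y)
    (Q : LinearMap.BilinForm ℝ V) (hQ : ∀ h X Y, Q (ρ h X) (ρ h Y) = Q X Y)
    (hQsymm : ∀ X Y, Q X Y = Q Y X) (hQpos : ∀ X ∈ 𝔪, X ≠ 0 → 0 < Q X X)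
    (A : 𝔪 →ₗ[ℝ] 𝔪) (hA : ∀ X Y : 𝔪, B (A X) Y = Q X Y) :
    ∃ (μ : ∀ i, Fin (t i) → ℝ)
      (N : ∀ i, Fin (t i) → Fin (t i) → Matrix (Fin (𝓑.d i)) (Fin (𝓑.d i)) ℝ),
      (∀ i l, 0 < μ i l) ∧
      (∀ i l k, k < l → ∃ τ, IsScalarBlock (N i l k) τ) ∧
      LinearMap.toMatrix 𝓑.basis 𝓑.basis A =
        Matrix.blockDiagonal' fun i => isotypicalBlock (μ i) (N i) := by
  let N : ∀ i, Fin (t i) → Fin (t i) → Matrix (Fin (𝓑.d i)) (Fin (𝓑.d i)) ℝ := fun i l k =>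
    Matrix.of fun p q => Q (𝓑.basis ⟨i, (k, q)⟩) (𝓑.basis ⟨i, (l, p)⟩)
  have hN : ∀ i l k, ∃ τ, IsScalarBlock (N i l k) τ :=
    fun i l k => 𝓑.isScalarBlock_of_invariant hpos hinv Q hQ i l k
  have hdiag : ∀ i l, ∃ a : ℝ, N i l l = a • 1 := by
    intro i l
    obtain ⟨τ, hτ⟩ := hN i l l
    refine hτ.eq_smul_one ?_
    ext p q
    exact hQsymm _ _
  choose μ hμ using hdiag
  refine ⟨μ, N, ?_, fun i l k _ => hN i l k, ?_⟩
  · intro i l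
    -- positivity of `μ i l` is read off from a diagonal entry, so the summand must not be zero
    have : 0 < 𝓑.d i := by
      by_contra h
      have hd : 𝓑.d i = 0 := by omega
      have := hW.irreducible (e ⟨i, 0⟩)
      have : IsEmpty (Fin (𝓑.d i)) := by rw [hd]; infer_instance
      have hsub : Subsingleton (W (e ⟨i, 0⟩)).toSubmodule :=
        (𝓑.first i).repr.toEquiv.subsingleton
      obtain ⟨U, U', hU⟩ := exists_pair_ne (Subrepresentation (W (e ⟨i, 0⟩)).toRepresentation)
      apply hU
      apply Subrepresentation.toSubmodule_injective
      exact Subsingleton.elim _ _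
    have h1 := congrFun (congrFun (hμ i l) ⟨0, this⟩) ⟨0, this⟩
    simp only [N, Matrix.of_apply, Matrix.smul_apply, Matrix.one_apply_eq, smul_eq_mul,
      mul_one] at h1
    rw [← h1]
    refine hQpos _ (Subtype.property _) ?_
    simpa using 𝓑.basis.ne_zero _
  · ext ⟨i, l, p⟩ ⟨j, k, q⟩
    rw [𝓑.toMatrix_apply hW, hA]
    rcases eq_or_ne i j with rfl | hij
    · rw [Matrix.blockDiagonal'_apply_eq]
      simp only [isotypicalBlock, Matrix.of_apply]
      split_ifs with h1 h2
      · subst h1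
        rw [← hμ]
        rfl
      · rfl
      -- above the diagonal the entry is that of the transposed block
      · exact hQsymm _ _
    · rw [Matrix.blockDiagonal'_apply_ne _ _ _ hij]
      refine invariant_eq_zero_of_not_equiv hpos hinv Q hQ _ _ (hW.irreducible (e ⟨j, k⟩))
        (hW.irreducible (e ⟨i, l⟩)) ?_ (𝓑.basis_mem j k q) (𝓑.basis_mem i l p)
      rw [he]
      exact hij.symm

/-! ### Equivariance of the operator of a matrix with commuting blocks -/

open scoped Kronecker in
/-- A block matrix whose blocks commute with `R` commutes with `diag(R, …, R)`. -/
theorem commute_one_kronecker {t d : ℕ} {M : Matrix (Fin t × Fin d) (Fin t × Fin d) ℝ}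
    {R : Matrix (Fin d) (Fin d) ℝ}
    (h : ∀ l k, Commute (Matrix.of fun p q => M (l, p) (k, q)) R) :
    Commute M ((1 : Matrix (Fin t) (Fin t) ℝ) ⊗ₖ R) := by
  ext ⟨l, p⟩ ⟨k, q⟩
  have := congrFun (congrFun (h l k) p) q
  simpa [Matrix.mul_apply, Fintype.sum_prod_type, Matrix.one_apply, Matrix.kroneckerMap_apply,
    Finset.sum_ite_irrel] using this

theorem IsDecomposition.apply_mem (hW : IsDecomposition B 𝔪 W) (h : K) :
    ∀ X ∈ 𝔪, ρ h X ∈ 𝔪 := by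
  rw [← hW.iSup_eq]
  change (⨆ j, (W j).toSubmodule) ≤ (⨆ j, (W j).toSubmodule).comap (ρ h)
  refine iSup_le fun j X hX => ?_
  exact Submodule.mem_iSup_of_mem j ((W j).apply_mem_toSubmodule h hX)

/-- In an orthonormal basis the group acts by orthogonal matrices. -/
theorem AdaptedBasis.transpose_toMatrix_first (𝓑 : AdaptedBasis B 𝔪 W e)
    (hsymm : ∀ X Y, B X Y = B Y X) (hinv : ∀ h X Y, B (ρ h X) (ρ h Y) = B X Y)
    (i : Fin S) (h : K) :
    (LinearMap.toMatrix (𝓑.first i) (𝓑.first i) ((W (e ⟨i, 0⟩)).toRepresentation h)).transpose =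
      LinearMap.toMatrix (𝓑.first i) (𝓑.first i) ((W (e ⟨i, 0⟩)).toRepresentation h⁻¹) := by
  ext p q
  rw [Matrix.transpose_apply, LinearMap.toMatrix_apply, LinearMap.toMatrix_apply,
    repr_eq_of_orthonormal (B := B) _ (𝓑.first_orthonormal i),
    repr_eq_of_orthonormal (B := B) _ (𝓑.first_orthonormal i)]
  change B (ρ h (𝓑.first i p)) (𝓑.first i q) = B (ρ h⁻¹ (𝓑.first i q)) (𝓑.first i p)
  rw [← hinv h (ρ h⁻¹ _), hsymm]
  simp

open scoped Kronecker in
/-- In an adapted basis, `h` acts by the same matrix on all summands of an isotypical class. -/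
theorem AdaptedBasis.toMatrix_restrict (𝓑 : AdaptedBasis B 𝔪 W e)
    (hW : IsDecomposition B 𝔪 W) (h : K) :
    LinearMap.toMatrix 𝓑.basis 𝓑.basis ((ρ h).restrict (hW.apply_mem h)) =
      Matrix.blockDiagonal' fun i => (1 : Matrix (Fin (t i)) (Fin (t i)) ℝ) ⊗ₖ
        LinearMap.toMatrix (𝓑.first i) (𝓑.first i) ((W (e ⟨i, 0⟩)).toRepresentation h) := by
  ext ⟨i, l, p⟩ ⟨j, k, q⟩
  rw [LinearMap.toMatrix_apply]
  have hr : (ρ h).restrict (hW.apply_mem h) (𝓑.basis ⟨j, (k, q)⟩) =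
      ∑ p', LinearMap.toMatrix (𝓑.first j) (𝓑.first j) ((W (e ⟨j, 0⟩)).toRepresentation h) p' q •
        𝓑.basis ⟨j, (k, p')⟩ := by
    apply Subtype.ext
    rw [LinearMap.coe_restrict_apply, 𝓑.basis_apply, ← 𝓑.T_apply]
    conv_lhs => rw [← (𝓑.first j).sum_repr ((W (e ⟨j, 0⟩)).toRepresentation h (𝓑.first j q))]
    change (((W (e ⟨j, k⟩)).toSubmodule.subtype ∘ₗ (𝓑.T j k).toLinearMap) _) = _
    rw [map_sum, Submodule.coe_sum]
    refine Finset.sum_congr rfl fun p' _ => ?_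
    rw [map_smul, Submodule.coe_smul, 𝓑.basis_apply, LinearMap.toMatrix_apply]
    rfl
  rw [hr, map_sum, Finsupp.finsetSum_apply]
  simp only [map_smul, Module.Basis.repr_self, Finsupp.smul_apply, smul_eq_mul]
  rcases eq_or_ne i j with rfl | hij
  · rw [Matrix.blockDiagonal'_apply_eq]
    simp only [Finsupp.single_apply, Matrix.kroneckerMap_apply, Matrix.one_apply, Sigma.mk.injEq,
      heq_eq_eq, true_and, Prod.mk.injEq]
    rcases eq_or_ne l k with rfl | hlk
    · simp
    · simp [hlk, hlk.symm]
  · rw [Matrix.blockDiagonal'_apply_ne _ _ _ hij]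
    refine Finset.sum_eq_zero fun p' _ => ?_
    rw [Finsupp.single_eq_of_ne, mul_zero]
    intro hh
    exact hij (congrArg Sigma.fst hh)

/-- If the blocks below the diagonal commute with the group, then the operator is equivariant. -/
theorem AdaptedBasis.toLin_comm (𝓑 : AdaptedBasis B 𝔪 W e) (hW : IsDecomposition B 𝔪 W)
    (hsymm : ∀ X Y, B X Y = B Y X) (hinv : ∀ h X Y, B (ρ h X) (ρ h Y) = B X Y)
    (μ : ∀ i, Fin (t i) → ℝ)
    (N : ∀ i, Fin (t i) → Fin (t i) → Matrix (Fin (𝓑.d i)) (Fin (𝓑.d i)) ℝ)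
    (hN : ∀ i l k, k < l → ∀ h : K, Commute (N i l k) (LinearMap.toMatrix (𝓑.first i) (𝓑.first i)
      ((W (e ⟨i, 0⟩)).toRepresentation h)))
    (h : K) (X : 𝔪) :
    Matrix.toLin 𝓑.basis 𝓑.basis (Matrix.blockDiagonal' fun i => isotypicalBlock (μ i) (N i))
      ((ρ h).restrict (hW.apply_mem h) X) = (ρ h).restrict (hW.apply_mem h)
        (Matrix.toLin 𝓑.basis 𝓑.basis
          (Matrix.blockDiagonal' fun i => isotypicalBlock (μ i) (N i)) X) := by
  suffices hc : Matrix.toLin 𝓑.basis 𝓑.basis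
      (Matrix.blockDiagonal' fun i => isotypicalBlock (μ i) (N i)) ∘ₗ
        (ρ h).restrict (hW.apply_mem h) = (ρ h).restrict (hW.apply_mem h) ∘ₗ
      Matrix.toLin 𝓑.basis 𝓑.basis (Matrix.blockDiagonal' fun i => isotypicalBlock (μ i) (N i)) from
    LinearMap.congr_fun hc X
  apply (LinearMap.toMatrix 𝓑.basis 𝓑.basis).injective
  rw [LinearMap.toMatrix_comp 𝓑.basis 𝓑.basis 𝓑.basis,
    LinearMap.toMatrix_comp 𝓑.basis 𝓑.basis 𝓑.basis, LinearMap.toMatrix_toLin,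
    𝓑.toMatrix_restrict hW, ← Matrix.blockDiagonal'_mul, ← Matrix.blockDiagonal'_mul]
  congr 1
  ext1 i
  refine commute_one_kronecker fun l k => ?_
  rcases lt_trichotomy l k with hlk | rfl | hkl
  · -- above the diagonal: transpose the relation for `h⁻¹`, as `h` acts by an orthogonal matrix
    have h1 := congrArg Matrix.transpose (hN i k l hlk h⁻¹).eq
    rw [Matrix.transpose_mul, Matrix.transpose_mul,
      𝓑.transpose_toMatrix_first hsymm hinv, inv_inv] at h1
    have h2 : (Matrix.of fun p q => isotypicalBlock (μ i) (N i) (l, p) (k, q)) =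
        (N i k l).transpose := by
      ext p q
      simp [isotypicalBlock, hlk.ne, hlk.not_gt]
    rw [h2]
    exact h1.symm
  · have h2 : (Matrix.of fun p q => isotypicalBlock (μ i) (N i) (l, p) (l, q)) =
        μ i l • 1 := by
      ext p q
      simp [isotypicalBlock]
    rw [h2]
    exact (Commute.one_left _).smul_left _
  · have h2 : (Matrix.of fun p q => isotypicalBlock (μ i) (N i) (l, p) (k, q)) = N i l k := by
      ext p q
      simp [isotypicalBlock, hkl, hkl.ne']
    rw [h2]
    exact hN i l k hkl h

theorem AdaptedBasis.inner_toLin_comm (𝓑 : AdaptedBasis B 𝔪 W e) (hW : IsDecomposition B 𝔪 W)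
    {D : Matrix (Σ i, Fin (t i) × Fin (𝓑.d i)) (Σ i, Fin (t i) × Fin (𝓑.d i)) ℝ}
    (hD : D.PosDef) (X Y : 𝔪) :
    B (Matrix.toLin 𝓑.basis 𝓑.basis D X) Y = B (Matrix.toLin 𝓑.basis 𝓑.basis D Y) X := by
  have hT : D.transpose = D := by simpa using hD.isHermitian.eq
  rw [𝓑.inner_toLin hW, 𝓑.inner_toLin hW, Matrix.dotProduct_mulVec, ← Matrix.mulVec_transpose, hT,
    dotProduct_comm]

theorem AdaptedBasis.inner_toLin_pos (𝓑 : AdaptedBasis B 𝔪 W e) (hW : IsDecomposition B 𝔪 W)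
    {D : Matrix (Σ i, Fin (t i) × Fin (𝓑.d i)) (Σ i, Fin (t i) × Fin (𝓑.d i)) ℝ}
    (hD : D.PosDef) {X : 𝔪} (hX : X ≠ 0) :
    0 < B (Matrix.toLin 𝓑.basis 𝓑.basis D X) X := by
  rw [𝓑.inner_toLin hW]
  have h0 : (𝓑.basis.repr X : (Σ i, Fin (t i) × Fin (𝓑.d i)) → ℝ) ≠ 0 := by
    intro h
    exact hX (𝓑.basis.repr.map_eq_zero_iff.1 (DFunLike.coe_injective h))
  simpa using hD.dotProduct_mulVec_pos h0

end AdaptedBasis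

end InvMetric

end Algebra

/-! ### One-parameter subgroups and the Lie algebra of the isotropy group -/

section OneParameter

open InvMetric
open scoped Topology

namespace InvMetric

/-- An integral curve of a `C¹` vector field is `C¹`. -/
theorem contMDiff_of_isMIntegralCurve
    {E : Type*} [NormedAddCommGroup E] [NormedSpace ℝ E]
    {H : Type*} [TopologicalSpace H] {I : ModelWithCorners ℝ E H}
    {M : Type*} [TopologicalSpace M] [ChartedSpace H M] [IsManifold I 1 M]
    {v : (x : M) → TangentSpace I x} {γ : ℝ → M}
    (hv : ContMDiff I I.tangent 1 (fun x => (⟨x, v x⟩ : TangentBundle I M)))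
    (hγ : IsMIntegralCurve γ v) : ContMDiff 𝓘(ℝ, ℝ) I 1 γ := by
  intro t₀
  have hcont := hγ.continuous
  rw [contMDiffAt_iff_target]
  refine ⟨hcont.continuousAt, ?_⟩
  rw [contMDiffAt_iff_contDiffAt, contDiffAt_one_iff]
  -- in a chart the derivative of the curve is the field in coordinates, which is continuous
  have hder := (hγ.isMIntegralCurveAt t₀).eventually_hasDerivAt
  have hsrc : ∀ᶠ t in 𝓝 t₀, γ t ∈ (chartAt H (γ t₀)).source :=
    hcont.continuousAt.eventually_mem (chart_source_mem_nhds H (γ t₀))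
  refine ⟨fun t => (1 : ℝ →L[ℝ] ℝ).smulRight
    (tangentCoordChange I (γ t) (γ t₀) (γ t) (v (γ t))), _, hder.and hsrc, ?_, fun t ht =>
      ht.1.hasFDerivAt⟩
  have h1 : ContinuousOn (fun t => (trivializationAt E (TangentSpace I) (γ t₀)
      (⟨γ t, v (γ t)⟩ : TangentBundle I M)).2)
      {t | γ t ∈ (chartAt H (γ t₀)).source} := by
    refine continuous_snd.comp_continuousOn
      ((trivializationAt E (TangentSpace I) (γ t₀)).continuousOn.comp
        (hv.continuous.comp hcont).continuousOn ?_)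
    intro t ht
    rw [(trivializationAt E (TangentSpace I) (γ t₀)).mem_source]
    exact ht
  have h2 : ContinuousOn (fun t => tangentCoordChange I (γ t) (γ t₀) (γ t) (v (γ t)))
      {t | γ t ∈ (chartAt H (γ t₀)).source} := h1
  exact ((ContinuousLinearMap.smulRightL ℝ ℝ E 1).continuous.comp_continuousOn h2).mono
    fun t ht => ht.2

theorem mulInvariantVectorField_one
    {E : Type*} [NormedAddCommGroup E] [NormedSpace ℝ E]
    {HG : Type*} [TopologicalSpace HG] {I : ModelWithCorners ℝ E HG}
    {G : Type*} [TopologicalSpace G] [ChartedSpace HG G] [Group G] (X : GroupLieAlgebra I G) :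
    mulInvariantVectorField X (1 : G) = X := by
  change mfderiv I I (fun c : G => 1 * c) 1 X = X
  have : (fun c : G => 1 * c) = id := by funext c; simp
  rw [this, mfderiv_id]
  rfl

section

variable {E : Type*} [NormedAddCommGroup E] [NormedSpace ℝ E]
  {HG : Type*} [TopologicalSpace HG] {I : ModelWithCorners ℝ E HG}
  {G : Type*} [TopologicalSpace G] [ChartedSpace HG G] [Group G] [LieGroup I ∞ G]

theorem mdifferentiable_mul_left (a : G) : MDifferentiable I I (fun b : G => a * b) :=
  (contMDiff_mul_left (I := I) (n := ∞) (a := a)).mdifferentiable (by simp)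

theorem mfderiv_mul_left_mulInvariantVectorField (X : GroupLieAlgebra I G) (a b : G) :
    mfderiv I I (fun c : G => a * c) b (mulInvariantVectorField X b) =
      mulInvariantVectorField X (a * b) := by
  have h : (fun c : G => a * b * c) = (fun c => a * c) ∘ (fun c => b * c) := by
    funext c
    simp [mul_assoc]
  have key := mfderiv_comp_apply_of_eq (I := I) (I' := I) (I'' := I) (x := (1 : G))
    (mdifferentiable_mul_left (I := I) a b) (mdifferentiable_mul_left (I := I) b 1) (mul_one b) X
  rw [← h] at key
  exact key.symm

theorem contMDiff_one_mulInvariantVectorField (X : GroupLieAlgebra I G) :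
    ContMDiff I I.tangent 1
      (fun g : G => (⟨g, mulInvariantVectorField X g⟩ : TangentBundle I G)) := by
  have : LieGroup I (minSmoothness ℝ 3) G := by
    rw [minSmoothness_of_isRCLikeNormedField]
    exact LieGroup.of_le (n := ∞) ENat.LEInfty.out
  refine (contMDiff_mulInvariantVectorField (I := I) (G := G) X).of_le ?_
  rw [minSmoothness_of_isRCLikeNormedField]
  exact one_le_two

theorem isMIntegralCurveOn_mul_left {X : GroupLieAlgebra I G} {γ : ℝ → G} {s : Set ℝ}
    (hγ : IsMIntegralCurveOn γ (mulInvariantVectorField X : ∀ g : G, TangentSpace I g) s)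
    (a : G) : IsMIntegralCurveOn (fun t => a * γ t)
      (mulInvariantVectorField X : ∀ g : G, TangentSpace I g) s := by
  intro t ht
  have h := ((mdifferentiable_mul_left (I := I) a (γ t)).hasMFDerivAt).comp_hasMFDerivWithinAt t
    (hγ t ht)
  refine h.congr_mfderiv ?_
  ext
  refine Eq.symm ?_
  exact (congrArg (fun v => (1 : ℝ) • v)
    (mfderiv_mul_left_mulInvariantVectorField X a (γ t))).symm.trans
      (map_smul (mfderiv I I (fun c : G => a * c) (γ t)) (1 : ℝ) _).symm

/-- Every element of the Lie algebra is the velocity of a one-parameter subgroup. Integral curves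
of the invariant vector field exist for a uniform time by left translation, hence globally. -/
theorem exists_oneParameterSubgroup [FiniteDimensional ℝ E] [I.Boundaryless] [T2Space G]
    (X : GroupLieAlgebra I G) :
    ∃ γ : ℝ → G, ContMDiff 𝓘(ℝ, ℝ) I 1 γ ∧ (∀ s t, γ (s + t) = γ s * γ t) ∧
      (mfderiv 𝓘(ℝ, ℝ) I γ 0 : ℝ →L[ℝ] GroupLieAlgebra I G) 1 = X := by
  have : CompleteSpace E := FiniteDimensional.complete ℝ E
  have : IsManifold I 1 G := IsManifold.of_le (n := ∞) (by exact_mod_cast le_top)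
  have hv := contMDiff_one_mulInvariantVectorField X
  obtain ⟨γ₀, h0, hγ₀⟩ := exists_isMIntegralCurveAt_of_contMDiffAt_boundaryless 0
    (hv.contMDiffAt (x := 1))
  obtain ⟨ε, hε, hγ₀⟩ := isMIntegralCurveAt_iff'.1 hγ₀
  rw [Real.ball_eq_Ioo, zero_sub, zero_add] at hγ₀
  obtain ⟨γ, hγ0, hγ⟩ := exists_isMIntegralCurve_of_isMIntegralCurveOn hv hε
    (fun a => ⟨fun t => a * γ₀ t, by simp [h0], isMIntegralCurveOn_mul_left hγ₀ a⟩) 1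
  refine ⟨γ, contMDiff_of_isMIntegralCurve hv hγ, ?_, ?_⟩
  · intro s t
    -- `t ↦ γ s * γ t` and `t ↦ γ (s + t)` are integral curves with the same value at `0`
    have h1 : IsMIntegralCurve (fun t => γ s * γ t)
        (mulInvariantVectorField X : ∀ g : G, TangentSpace I g) := by
      rw [isMIntegralCurve_iff_isMIntegralCurveOn]
      exact isMIntegralCurveOn_mul_left (hγ.isMIntegralCurveOn _) (γ s)
    have h2 := hγ.comp_add s
    have h3 := isMIntegralCurve_Ioo_eq_of_contMDiff_boundaryless (t₀ := 0) hv h2 h1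
      (by simp [hγ0])
    have h4 := congrFun h3 t
    simpa [add_comm] using h4
  · rw [(hγ 0).mfderiv]
    change (1 : ℝ) • (mulInvariantVectorField X (γ 0) : E) = X
    rw [hγ0, one_smul]
    exact mulInvariantVectorField_one X

end

theorem mdifferentiable_smul_left {E : Type*} [NormedAddCommGroup E] [NormedSpace ℝ E]
    {HG : Type*} [TopologicalSpace HG] (I : ModelWithCorners ℝ E HG)
    {G : Type*} [TopologicalSpace G] [ChartedSpace HG G] [Group G]
    {F : Type*} [NormedAddCommGroup F] [NormedSpace ℝ F]
    {HM : Type*} [TopologicalSpace HM] (J : ModelWithCorners ℝ F HM)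
    {M : Type*} [TopologicalSpace M] [ChartedSpace HM M]
    [MulAction G M] [ContMDiffSMul I J ∞ G M] (a : G) :
    MDifferentiable J J (fun x : M => a • x) :=
  (ContMDiffSMul.contMDiff_const_smul (I := I) (I' := J) (n := ∞) a).mdifferentiable (by simp)

section

variable {E : Type*} [NormedAddCommGroup E] [NormedSpace ℝ E]
  {HG : Type*} [TopologicalSpace HG] {I : ModelWithCorners ℝ E HG}
  {G : Type*} [TopologicalSpace G] [ChartedSpace HG G] [Group G]
  {F : Type*} [NormedAddCommGroup F] [NormedSpace ℝ F]
  {HM : Type*} [TopologicalSpace HM] {J : ModelWithCorners ℝ F HM}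
  {M : Type*} [TopologicalSpace M] [ChartedSpace HM M]
  [MulAction G M] [ContMDiffSMul I J ∞ G M]

theorem contMDiff_orbitMap (o : M) : ContMDiff I J ∞ (fun b : G => b • o) :=
  (contMDiff_smul (I := I) (I' := J) (n := ∞) (G := G) (M := M)).comp
    (contMDiff_id.prodMk contMDiff_const)

theorem mdifferentiable_orbitMap (o : M) : MDifferentiable I J (fun b : G => b • o) :=
  (contMDiff_orbitMap o).mdifferentiable (by simp)

/-- Along a one-parameter subgroup, the orbit curve has zero velocity as soon as its initial
velocity vanishes: its velocities are translates of the initial one. -/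
theorem hasMFDerivAt_orbit_curve (o : M) {γ : ℝ → G} (hγ : MDifferentiable 𝓘(ℝ, ℝ) I γ)
    (hmul : ∀ s t, γ (s + t) = γ s * γ t) (t : ℝ)
    (h0 : orbitDeriv I J (G := G) o
      ((mfderiv 𝓘(ℝ, ℝ) I γ 0 : ℝ →L[ℝ] GroupLieAlgebra I G) 1) = 0) :
    HasMFDerivAt 𝓘(ℝ, ℝ) J (fun s => γ s • o) t (0 : ℝ →L[ℝ] F) := by
  have hγ0 : γ 0 = 1 := by simpa using hmul 0 0
  have hd : MDifferentiable 𝓘(ℝ, ℝ) J (fun s => γ s • o) :=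
    (mdifferentiable_orbitMap (I := I) (J := J) (G := G) o).comp hγ
  have hzero : (mfderiv 𝓘(ℝ, ℝ) J (fun s => γ s • o) 0 : ℝ →L[ℝ] F) 1 = 0 := by
    have key := mfderiv_comp_apply_of_eq (I := 𝓘(ℝ, ℝ)) (I' := I) (I'' := J) (x := (0 : ℝ))
      (mdifferentiable_orbitMap (I := I) (J := J) o 1) (hγ 0) hγ0 (1 : ℝ)
    exact key.trans h0
  have hz : (mfderiv 𝓘(ℝ, ℝ) J (fun s => γ s • o) 0 : ℝ →L[ℝ] F) = 0 := by
    ext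
    exact hzero
  -- near `t` the orbit curve is the image under `γ t` of the orbit curve near `0`
  have hshift : (fun s => γ s • o) = (fun x : M => γ t • x) ∘ (fun s => γ s • o) ∘
      (fun s => s - t) := by
    funext s
    simp only [Function.comp_apply, smul_smul, ← hmul]
    congr 2
    ring
  have hsub : HasMFDerivAt 𝓘(ℝ, ℝ) 𝓘(ℝ, ℝ) (fun s : ℝ => s - t) t
      (ContinuousLinearMap.id ℝ ℝ) :=
    ((hasFDerivAt_id t).sub_const t).hasMFDerivAt
  have h1 : HasMFDerivAt 𝓘(ℝ, ℝ) J (fun s => γ s • o) (t - t) (0 : ℝ →L[ℝ] F) := by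
    rw [sub_self]
    exact (hd 0).hasMFDerivAt.congr_mfderiv hz
  have h2 := HasMFDerivAt.comp (f := fun s : ℝ => s - t) (g := fun s => γ s • o) t h1 hsub
  have h3 := HasMFDerivAt.comp t
    ((mdifferentiable_smul_left I J (γ t)) (((fun s => γ s • o) ∘
      (fun s => s - t)) t)).hasMFDerivAt h2
  rw [← hshift] at h3
  refine h3.congr_mfderiv ?_
  ext
  exact (map_zero (mfderiv J J (fun x : M => γ t • x) (((fun s => γ s • o) ∘
    (fun s => s - t)) t)))

/-- A vector killed by the differential of the orbit map generates a one-parameter subgroup of the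
isotropy group: its orbit curve and the constant curve are integral curves of the zero field. -/
theorem exists_oneParameterSubgroup_stabilizer [LieGroup I ∞ G] [FiniteDimensional ℝ E]
    [I.Boundaryless] [T2Space G] [IsManifold J ∞ M] [T2Space M] [J.Boundaryless] (o : M)
    {X : GroupLieAlgebra I G} (hX : orbitDeriv I J o X = 0) :
    ∃ γ : ℝ → G, ContMDiff 𝓘(ℝ, ℝ) I 1 γ ∧ (∀ s t, γ (s + t) = γ s * γ t) ∧
      (∀ t, γ t ∈ MulAction.stabilizer G o) ∧
      (mfderiv 𝓘(ℝ, ℝ) I γ 0 : ℝ →L[ℝ] GroupLieAlgebra I G) 1 = X := by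
  have : IsManifold J 1 M := IsManifold.of_le (n := ∞) (by exact_mod_cast le_top)
  obtain ⟨γ, hγ, hmul, rfl⟩ := exists_oneParameterSubgroup X
  have hγ0 : γ 0 = 1 := by simpa using hmul 0 0
  refine ⟨γ, hγ, hmul, ?_, rfl⟩
  have h1 : IsMIntegralCurve (fun s => γ s • o) (fun x : M => (0 : TangentSpace J x)) := by
    intro t
    refine (hasMFDerivAt_orbit_curve o (hγ.mdifferentiable one_ne_zero) hmul t hX).congr_mfderiv ?_
    ext
    exact Eq.symm <| smul_zero (A := F) (1 : ℝ)
  have h2 : IsMIntegralCurve (fun _ : ℝ => o) (fun x : M => (0 : TangentSpace J x)) := by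
    intro t
    refine (hasMFDerivAt_const (I := 𝓘(ℝ, ℝ)) (I' := J) o t).congr_mfderiv ?_
    ext
    exact Eq.symm <| smul_zero (A := F) (1 : ℝ)
  have h3 := isMIntegralCurve_Ioo_eq_of_contMDiff_boundaryless (t₀ := 0)
    (Bundle.contMDiff_zeroSection ℝ (TangentSpace J : M → Type _)) h1 h2 (by simp [hγ0])
  intro t
  exact congrFun h3 t

/-- The Lie algebra of the isotropy group is the kernel of the differential of the orbit map. -/
theorem mem_lieAlgebraOf_stabilizer [LieGroup I ∞ G] [FiniteDimensional ℝ E] [I.Boundaryless]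
    [T2Space G] [IsManifold J ∞ M] [T2Space M] [J.Boundaryless] (o : M) (X : GroupLieAlgebra I G) :
    X ∈ lieAlgebraOf I (MulAction.stabilizer G o) ↔ orbitDeriv I J o X = 0 := by
  constructor
  · rintro ⟨γ, hγ, hmul, hstab, rfl⟩
    have hγ0 : γ 0 = 1 := by simpa using hmul 0 0
    have key := mfderiv_comp_apply_of_eq (I := 𝓘(ℝ, ℝ)) (I' := I) (I'' := J) (x := (0 : ℝ))
      (mdifferentiable_orbitMap (I := I) (J := J) o 1) (hγ 0) hγ0 (1 : ℝ)
    have hc : (fun b : G => b • o) ∘ γ = fun _ => o := by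
      funext t
      exact MulAction.mem_stabilizer_iff.1 (hstab t)
    rw [hc, mfderiv_const] at key
    exact key.symm
  · intro hX
    obtain ⟨γ, hγ, hmul, hstab, hγX⟩ := exists_oneParameterSubgroup_stabilizer o hX
    exact ⟨γ, hγ.mdifferentiable one_ne_zero, hmul, hstab, hγX⟩

end

end InvMetric

end OneParameter

/-! ### Local parametrizations of a homogeneous space -/

section Surjectivity

open InvMetric
open scoped Topology

namespace InvMetric

/-- The inverse function theorem for a map from a normed space to a manifold. -/
theorem exists_local_rightInverse
    {V : Type*} [NormedAddCommGroup V] [NormedSpace ℝ V] [CompleteSpace V]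
    {F : Type*} [NormedAddCommGroup F] [NormedSpace ℝ F]
    {H : Type*} [TopologicalSpace H] {J : ModelWithCorners ℝ F H} [J.Boundaryless]
    {M : Type*} [TopologicalSpace M] [ChartedSpace H M] {n : WithTop ℕ∞} [IsManifold J n M]
    (hn : n ≠ 0) {f : V → M} {v : V} (hf : ContMDiffAt 𝓘(ℝ, V) J n f v) (e : V ≃L[ℝ] F)
    (he : HasMFDerivAt 𝓘(ℝ, V) J f v (e : V →L[ℝ] F)) :
    ∃ g : M → V, g (f v) = v ∧ ContMDiffAt J 𝓘(ℝ, V) n g (f v) ∧ ∀ᶠ y in 𝓝 (f v), f (g y) = y := by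
  have hh : ContDiffAt ℝ n (extChartAt J (f v) ∘ f) v :=
    contMDiffAt_iff_contDiffAt.1 (contMDiffAt_iff_target.1 hf).2
  have hd : HasFDerivAt (extChartAt J (f v) ∘ f) (e : V →L[ℝ] F) v := by
    have h := he.2
    rw [ModelWithCorners.range_eq_univ] at h
    exact hasFDerivWithinAt_univ.1 h
  let g : M → V := hh.localInverse hd hn ∘ extChartAt J (f v)
  have hgv : g (f v) = v := hh.localInverse_apply_image hd hn
  have hg : ContMDiffAt J 𝓘(ℝ, V) n g (f v) := by
    refine ContMDiffAt.comp (f v) (I' := 𝓘(ℝ, F)) ?_ contMDiffAt_extChartAt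
    exact (hh.to_localInverse hd hn).contMDiffAt
  refine ⟨g, hgv, hg, ?_⟩
  have h1 : ∀ᶠ z in 𝓝 (extChartAt J (f v) (f v)),
      extChartAt J (f v) (f (hh.localInverse hd hn z)) = z :=
    (hh.hasStrictFDerivAt' hd hn).eventually_right_inverse
  have h2 := (continuousAt_extChartAt (I := J) (f v)).eventually h1
  have h3 : ∀ᶠ y in 𝓝 (f v), f (g y) ∈ (extChartAt J (f v)).source := by
    have hc : ContinuousAt (fun y => f (g y)) (f v) :=
      ContinuousAt.comp (by rw [hgv]; exact hf.continuousAt) hg.continuousAt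
    refine hc.eventually_mem ?_
    rw [hgv]
    exact extChartAt_source_mem_nhds (f v)
  filter_upwards [h2, h3, extChartAt_source_mem_nhds (I := J) (f v)] with y hy1 hy2 hy3
  exact (extChartAt J (f v)).injOn hy2 hy3 hy1

/-- Around each point there is a parametrization by the model space with identity differential. -/
theorem exists_parametrization
    {F : Type*} [NormedAddCommGroup F] [NormedSpace ℝ F]
    {H : Type*} [TopologicalSpace H] (J : ModelWithCorners ℝ F H) [J.Boundaryless]
    {M : Type*} [TopologicalSpace M] [ChartedSpace H M] (n : WithTop ℕ∞) [IsManifold J n M]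
    (x : M) : ∃ c : F → M, ContMDiffAt 𝓘(ℝ, F) J n c 0 ∧ c 0 = x ∧
      HasMFDerivAt 𝓘(ℝ, F) J c 0 (ContinuousLinearMap.id ℝ F) := by
  let c : F → M := fun v => (extChartAt J x).symm (extChartAt J x x + v)
  have hc0 : c 0 = x := by simp [c]
  have hev : ∀ᶠ v : F in 𝓝 0, extChartAt J x x + v ∈ (extChartAt J x).target := by
    have h1 : ContinuousAt (fun v : F => extChartAt J x x + v) 0 := by fun_prop
    refine h1.eventually_mem ?_
    rw [add_zero]
    exact extChartAt_target_mem_nhds x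
  have hc : ContMDiffAt 𝓘(ℝ, F) J n c 0 := by
    have h1 : ContMDiffAt 𝓘(ℝ, F) J n (extChartAt J x).symm (extChartAt J x x + 0) := by
      refine (contMDiffOn_extChartAt_symm (n := n) x).contMDiffAt ?_
      rw [add_zero]
      exact extChartAt_target_mem_nhds x
    have h2 : ContMDiffAt 𝓘(ℝ, F) 𝓘(ℝ, F) n (fun v : F => extChartAt J x x + v) 0 := by
      rw [contMDiffAt_iff_contDiffAt]
      fun_prop
    exact ContMDiffAt.comp (0 : F) h1 h2
  refine ⟨c, hc, hc0, hc.continuousAt, ?_⟩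
  rw [ModelWithCorners.range_eq_univ]
  suffices h : HasFDerivAt (extChartAt J (c 0) ∘ c) (ContinuousLinearMap.id ℝ F) 0 from
    hasFDerivWithinAt_univ.2 h
  rw [hc0]
  have h1 : HasFDerivAt (fun v : F => extChartAt J x x + v) (ContinuousLinearMap.id ℝ F) 0 :=
    (hasFDerivAt_id (0 : F)).const_add _
  refine h1.congr_of_eventuallyEq ?_
  filter_upwards [hev] with v hv
  exact (extChartAt J x).right_inv hv

section Product

variable {E : Type*} [NormedAddCommGroup E] [NormedSpace ℝ E]
  {HG : Type*} [TopologicalSpace HG] {I : ModelWithCorners ℝ E HG}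
  {G : Type*} [TopologicalSpace G] [ChartedSpace HG G] [Group G] [LieGroup I ∞ G]

/-- The differential of a product of two maps through the identity is the sum of the differentials.
-/
theorem hasMFDerivAt_mul_of_eq_one {V : Type*} [NormedAddCommGroup V] [NormedSpace ℝ V]
    {a b : V → G} {x : V} (ha : a x = 1) (hb : b x = 1) {a' b' : V →L[ℝ] E}
    (hda : HasMFDerivAt 𝓘(ℝ, V) I a x a') (hdb : HasMFDerivAt 𝓘(ℝ, V) I b x b') :
    HasMFDerivAt 𝓘(ℝ, V) I (fun y => a y * b y) x (a' + b') := by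
  have hm : MDifferentiableAt (I.prod I) I (fun p : G × G => p.1 * p.2) (a x, b x) :=
    (contMDiff_mul I ∞).mdifferentiable (by simp) _
  refine (HasMFDerivAt.comp (f := fun y => (a y, b y)) (g := fun p : G × G => p.1 * p.2) x
    hm.hasMFDerivAt (hda.prodMk hdb)).congr_mfderiv ?_
  ext v
  have key := mfderiv_prod_eq_add_apply (v := (a' v, b' v)) hm
  refine key.trans ?_
  have h1 : (fun z : G => z * b x) = id := by funext z; simp [hb]
  have h2 : (fun z : G => a x * z) = id := by funext z; simp [ha]
  change mfderiv I I (fun z : G => z * b x) (a x) (a' v) +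
    mfderiv I I (fun z : G => a x * z) (b x) (b' v) = _
  rw [h1, h2, mfderiv_id, mfderiv_id]
  rfl

/-- Coordinates of the second kind in a subgroup: products of one-parameter subgroups. -/
theorem exists_contMDiff_of_oneParameterSubgroups (K : Subgroup G) {n : ℕ}
    (γ : Fin n → ℝ → G) (X : Fin n → E) (hγ : ∀ j, ContMDiff 𝓘(ℝ, ℝ) I 1 (γ j))
    (hγ0 : ∀ j, γ j 0 = 1) (hK : ∀ j t, γ j t ∈ K)
    (hX : ∀ j, HasMFDerivAt 𝓘(ℝ, ℝ) I (γ j) 0 ((1 : ℝ →L[ℝ] ℝ).smulRight (X j))) :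
    ∃ P : (Fin n → ℝ) → G, ContMDiff 𝓘(ℝ, Fin n → ℝ) I 1 P ∧ P 0 = 1 ∧ (∀ t, P t ∈ K) ∧
      ∃ P' : (Fin n → ℝ) →L[ℝ] E, HasMFDerivAt 𝓘(ℝ, Fin n → ℝ) I P 0 P' ∧
        ∀ v, P' v = ∑ j, v j • X j := by
  induction n with
  | zero =>
    refine ⟨fun _ => 1, contMDiff_const, rfl, fun _ => K.one_mem, 0,
      hasMFDerivAt_const _ _, fun v => ?_⟩
    rw [Fin.sum_univ_zero]
    rfl
  | succ n ih =>
    obtain ⟨P, hP, hP0, hPK, P', hP', hPv⟩ := ih (fun j => γ j.succ) (fun j => X j.succ)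
      (fun j => hγ _) (fun j => hγ0 _) (fun j => hK _) (fun j => hX _)
    let p₀ : (Fin (n + 1) → ℝ) →L[ℝ] ℝ := ContinuousLinearMap.proj 0
    let p₁ : (Fin (n + 1) → ℝ) →L[ℝ] (Fin n → ℝ) :=
      ContinuousLinearMap.pi fun j => ContinuousLinearMap.proj j.succ
    let Q₀ : (Fin (n + 1) → ℝ) →L[ℝ] E := ((1 : ℝ →L[ℝ] ℝ).smulRight (X 0)) ∘L p₀
    let Q₁ : (Fin (n + 1) → ℝ) →L[ℝ] E := P' ∘L p₁
    have h0 : HasMFDerivAt 𝓘(ℝ, Fin (n + 1) → ℝ) I (fun t => γ 0 (p₀ t)) 0 Q₀ := by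
      refine HasMFDerivAt.comp (g := γ 0) (f := p₀) (0 : Fin (n + 1) → ℝ) ?_
        p₀.hasFDerivAt.hasMFDerivAt
      rw [map_zero]
      exact hX 0
    have h1 : HasMFDerivAt 𝓘(ℝ, Fin (n + 1) → ℝ) I (fun t => P (p₁ t)) 0 Q₁ := by
      refine HasMFDerivAt.comp (g := P) (f := p₁) (0 : Fin (n + 1) → ℝ) ?_
        p₁.hasFDerivAt.hasMFDerivAt
      rw [map_zero]
      exact hP'
    refine ⟨fun t => γ 0 (p₀ t) * P (p₁ t), ?_, ?_, fun t => K.mul_mem (hK _ _) (hPK _), Q₀ + Q₁,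
      hasMFDerivAt_mul_of_eq_one ?_ ?_ h0 h1, ?_⟩
    · have : LieGroup I 1 G := LieGroup.of_le (n := ∞) ENat.LEInfty.out
      exact ((hγ 0).comp p₀.contDiff.contMDiff).mul (hP.comp p₁.contDiff.contMDiff)
    · simp [hγ0, hP0]
    · simp [hγ0]
    · simp [hP0]
    · intro v
      rw [Fin.sum_univ_succ]
      exact congrArg₂ (· + ·) rfl (hPv (p₁ v))

end Product

/-! ### The orbit map is a submersion -/

/-- The differential of the orbit map, as a map between the model spaces. -/
noncomputable def orbitLinear {E : Type*} [NormedAddCommGroup E] [NormedSpace ℝ E]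
    {HG : Type*} [TopologicalSpace HG] (I : ModelWithCorners ℝ E HG)
    (G : Type*) [TopologicalSpace G] [ChartedSpace HG G] [Group G]
    {F : Type*} [NormedAddCommGroup F] [NormedSpace ℝ F]
    {HM : Type*} [TopologicalSpace HM] (J : ModelWithCorners ℝ F HM)
    {M : Type*} [TopologicalSpace M] [ChartedSpace HM M] [MulAction G M] (o : M) : E →L[ℝ] F :=
  orbitDeriv I J (G := G) o

section Orbit

variable {E : Type*} [NormedAddCommGroup E] [NormedSpace ℝ E] [FiniteDimensional ℝ E]
  {HG : Type*} [TopologicalSpace HG] {I : ModelWithCorners ℝ E HG} [I.Boundaryless]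
  {G : Type*} [TopologicalSpace G] [ChartedSpace HG G] [Group G] [LieGroup I ∞ G] [T2Space G]
  {F : Type*} [NormedAddCommGroup F] [NormedSpace ℝ F]
  {HM : Type*} [TopologicalSpace HM] {J : ModelWithCorners ℝ F HM} [J.Boundaryless]
  {M : Type*} [TopologicalSpace M] [ChartedSpace HM M] [IsManifold J ∞ M] [T2Space M]
  [MulAction G M] [ContMDiffSMul I J ∞ G M]

/-- Near `1`, the group is the product of a slice transverse to the isotropy group and of the
isotropy group. So near `o` the orbit is parametrized by a complement of the kernel of the
differential of the orbit map. -/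
theorem exists_slice (o : M) (𝔭 : Submodule ℝ E)
    (h𝔭 : IsCompl 𝔭 (LinearMap.ker (orbitLinear I G J o).toLinearMap)) :
    ∃ c : 𝔭 → G, ContMDiffAt 𝓘(ℝ, 𝔭) I ∞ c 0 ∧ c 0 = 1 ∧
      HasMFDerivAt 𝓘(ℝ, 𝔭) I c 0 𝔭.subtypeL ∧
      ∀ u ∈ 𝓝 (0 : 𝔭), ∀ᶠ b in 𝓝 (1 : G), ∃ p ∈ u, b • o = c p • o := by
  have : CompleteSpace E := FiniteDimensional.complete ℝ E
  obtain ⟨c, hc, hc0, hcd⟩ := exists_parametrization I ∞ (1 : G)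
  let k : Submodule ℝ E := LinearMap.ker (orbitLinear I G J o).toLinearMap
  let β : Module.Basis (Fin (Module.finrank ℝ k)) ℝ k := Module.finBasis ℝ k
  have hβ : ∀ j, orbitDeriv I J (G := G) o (β j : E) = 0 := fun j => (β j).2
  choose γ hγ hmul hstab hγd using fun j =>
    exists_oneParameterSubgroup_stabilizer (I := I) (J := J) (G := G) o (hβ j)
  have hγ0 : ∀ j, γ j 0 = 1 := fun j => by simpa using hmul j 0 0
  obtain ⟨P, hP, hP0, hPK, P', hP', hPv⟩ := exists_contMDiff_of_oneParameterSubgroups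
    (MulAction.stabilizer G o) γ (fun j => (β j : E)) hγ hγ0 hstab (fun j => by
      refine ((hγ j).mdifferentiable one_ne_zero 0).hasMFDerivAt.congr_mfderiv ?_
      ext
      exact (hγd j).trans (one_smul ℝ (β j : E)).symm)
  have hc1 : ContMDiffAt 𝓘(ℝ, 𝔭) I ∞ (fun p : 𝔭 => c p) 0 := by
    refine ContMDiffAt.comp (g := c) (f := fun p : 𝔭 => (p : E)) (I' := 𝓘(ℝ, E)) (0 : 𝔭) ?_
      𝔭.subtypeL.contDiff.contMDiff.contMDiffAt
    exact hc
  have hc1d : HasMFDerivAt 𝓘(ℝ, 𝔭) I (fun p : 𝔭 => c p) 0 𝔭.subtypeL :=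
    HasMFDerivAt.comp (g := c) (f := fun p : 𝔭 => (p : E)) (0 : 𝔭) hcd
      𝔭.subtypeL.hasFDerivAt.hasMFDerivAt
  refine ⟨fun p => c p, hc1, hc0, hc1d, ?_⟩
  intro u hu
  -- the inverse function theorem applies to the product of the slice and of coordinates of the
  -- second kind in the isotropy group, whose differential is the splitting `𝔭 ⊕ ker`
  let V := 𝔭 × (Fin (Module.finrank ℝ k) → ℝ)
  let Φ : V → G := fun y => c y.1 * P y.2
  let e : V ≃L[ℝ] E := ((LinearEquiv.prodCongr (LinearEquiv.refl ℝ 𝔭) β.equivFun.symm).trans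
    (Submodule.prodEquivOfIsCompl 𝔭 k h𝔭)).toContinuousLinearEquiv
  let q₀ : V →L[ℝ] E := 𝔭.subtypeL ∘L ContinuousLinearMap.fst ℝ _ _
  let q₁ : V →L[ℝ] E := P' ∘L ContinuousLinearMap.snd ℝ _ _
  have hΦ0 : Φ 0 = 1 := by simp [Φ, hc0, hP0]
  have hΦd : HasMFDerivAt 𝓘(ℝ, V) I Φ 0 (e : V →L[ℝ] E) := by
    have h0 : HasMFDerivAt 𝓘(ℝ, V) I (fun y : V => c y.1) 0 q₀ :=
      HasMFDerivAt.comp (g := fun p : 𝔭 => c p) (f := fun y : V => y.1) (0 : V) hc1d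
        hasFDerivAt_fst.hasMFDerivAt
    have h1 : HasMFDerivAt 𝓘(ℝ, V) I (fun y : V => P y.2) 0 q₁ :=
      HasMFDerivAt.comp (g := P) (f := fun y : V => y.2) (0 : V) hP'
        hasFDerivAt_snd.hasMFDerivAt
    have h2 : q₀ + q₁ = (e : V →L[ℝ] E) := by
      refine ContinuousLinearMap.ext fun y => ?_
      have h3 : (e : V →L[ℝ] E) y = (y.1 : E) + ((β.equivFun.symm y.2 : k) : E) :=
        Submodule.coe_prodEquivOfIsCompl' 𝔭 k h𝔭 (y.1, β.equivFun.symm y.2)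
      rw [h3, Module.Basis.equivFun_symm_apply]
      change (y.1 : E) + P' y.2 = _
      rw [hPv, Submodule.coe_sum]
      rfl
    rw [← h2]
    exact hasMFDerivAt_mul_of_eq_one (a := fun y : V => c y.1) (b := fun y : V => P y.2) hc0 hP0
      h0 h1
  have hΦ : ContMDiffAt 𝓘(ℝ, V) I 1 Φ 0 := by
    have : LieGroup I 1 G := LieGroup.of_le (n := ∞) ENat.LEInfty.out
    refine ContMDiffAt.mul ?_ ?_
    · exact ContMDiffAt.comp (g := fun p : 𝔭 => c p) (f := fun y : V => y.1) (I' := 𝓘(ℝ, 𝔭)) (0 : V)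
        (hc1.of_le ENat.LEInfty.out) contDiff_fst.contMDiff.contMDiffAt
    · exact (hP.comp (f := fun y : V => y.2) contDiff_snd.contMDiff).contMDiffAt
  have : IsManifold I 1 G := IsManifold.of_le (n := ∞) ENat.LEInfty.out
  obtain ⟨g, hg0, hg, hgr⟩ := exists_local_rightInverse one_ne_zero hΦ e hΦd
  rw [hΦ0] at hg0 hg hgr
  have hgu : ∀ᶠ b in 𝓝 (1 : G), (g b).1 ∈ u := by
    refine (continuous_fst.continuousAt.comp hg.continuousAt).eventually_mem ?_
    simpa [hg0] using hu
  filter_upwards [hgr, hgu] with b hb hbu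
  refine ⟨(g b).1, hbu, ?_⟩
  conv_lhs => rw [← hb]
  simp only [Φ, mul_smul]
  rw [MulAction.mem_stabilizer_iff.1 (hPK _)]

/-- The orbit map of a transitive action of a compact Lie group is a submersion. Otherwise the
orbit would locally be the image of a smooth map from a space of smaller dimension, hence a finite
union of closed sets with empty interior. -/
theorem orbitDeriv_surjective [CompactSpace G] [FiniteDimensional ℝ F]
    [MulAction.IsPretransitive G M] (o : M) :
    Function.Surjective (orbitLinear I G J o) := by
  by_contra hns
  have : IsTopologicalGroup G := topologicalGroup_of_lieGroup I ∞
  have : ContinuousSMul G M := ContMDiffSMul.continuousSMul (I := I) (I' := J) ∞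
  have : CompactSpace M :=
    Function.Surjective.compactSpace (contMDiff_orbitMap (I := I) (J := J) o).continuous
      (MulAction.surjective_smul G o)
  let φ : E →ₗ[ℝ] F := (orbitLinear I G J o).toLinearMap
  obtain ⟨𝔭, h𝔭⟩ := (LinearMap.ker φ).exists_isCompl
  have hdim : Module.finrank ℝ 𝔭 < Module.finrank ℝ F := by
    have h1 := Submodule.finrank_add_eq_of_isCompl h𝔭
    have h2 := LinearMap.finrank_range_add_finrank_ker φ
    have h3 : Module.finrank ℝ (LinearMap.range φ) < Module.finrank ℝ F :=
      Submodule.finrank_lt fun h => hns (LinearMap.range_eq_top.1 h)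
    omega
  obtain ⟨c, hc, hc0, -, hslice⟩ := exists_slice (I := I) (J := J) o 𝔭 h𝔭.symm
  let f : 𝔭 → F := fun p => extChartAt J o (c p • o)
  have hf : ContDiffAt ℝ 1 f 0 := by
    rw [← contMDiffAt_iff_contDiffAt]
    have h1 : ContMDiffAt 𝓘(ℝ, 𝔭) J 1 (fun p => c p • o) 0 :=
      ((contMDiff_orbitMap (I := I) (J := J) (G := G) o).contMDiffAt.comp (0 : 𝔭) hc).of_le
        ENat.LEInfty.out
    refine ContMDiffAt.comp (0 : 𝔭) (I' := J) ?_ h1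
    rw [hc0, one_smul]
    exact contMDiffAt_extChartAt
  -- in a chart, the orbit points near `o` lie in the image of a ball of too small a dimension
  obtain ⟨r, hr, hball⟩ := Metric.eventually_nhds_iff_ball.1 (hf.eventually (by simp))
  have hdense : Dense (f '' Metric.ball 0 r)ᶜ := by
    refine ContDiffOn.dense_compl_image_of_dimH_lt_finrank
      (fun p hp => (hball p hp).contDiffWithinAt) (convex_ball 0 r) subset_rfl ?_
    calc dimH (Metric.ball (0 : 𝔭) r) ≤ dimH (Set.univ : Set 𝔭) := dimH_mono (Set.subset_univ _)
      _ = Module.finrank ℝ 𝔭 := Real.dimH_univ_eq_finrank 𝔭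
      _ < Module.finrank ℝ F := by exact_mod_cast hdim
  have hsrc : ∀ᶠ b in 𝓝 (1 : G), b • o ∈ (extChartAt J o).source := by
    have h1 : ContinuousAt (fun b : G => b • o) 1 := by fun_prop
    refine h1.eventually_mem ?_
    rw [one_smul]
    exact extChartAt_source_mem_nhds o
  obtain ⟨K, hK1, hKS, hK⟩ := local_compact_nhds
    ((hslice _ (Metric.ball_mem_nhds 0 hr)).and hsrc)
  -- `C` is a compact piece of the orbit around `o`: it has empty interior, but finitely many of its
  -- translates cover `M`
  let C : Set M := (fun b : G => b • o) '' K
  have hC : IsClosed C := (hK.image (by fun_prop)).isClosed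
  have hCint : interior C = ∅ := by
    by_contra hne
    obtain ⟨x, hx⟩ := Set.nonempty_iff_ne_empty.2 hne
    have hO : IsOpen ((extChartAt J o).target ∩ (extChartAt J o).symm ⁻¹' interior C) :=
      (continuousOn_extChartAt_symm o).isOpen_inter_preimage (isOpen_extChartAt_target o)
        isOpen_interior
    have hCsrc : ∀ y ∈ C, y ∈ (extChartAt J o).source := by
      rintro y ⟨b, hb, rfl⟩
      exact (hKS hb).2
    obtain ⟨w, ⟨hwt, hwC⟩, hw⟩ := hdense.inter_open_nonempty _ hO
      ⟨extChartAt J o x, (extChartAt J o).map_source (hCsrc x (interior_subset hx)), by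
        rw [Set.mem_preimage, (extChartAt J o).left_inv (hCsrc x (interior_subset hx))]
        exact hx⟩
    obtain ⟨b, hb, hbw⟩ := interior_subset hwC
    obtain ⟨p, hp, hbp⟩ := (hKS hb).1
    refine hw ⟨p, hp, ?_⟩
    change extChartAt J o (c p • o) = w
    rw [← hbp]
    refine (congrArg (extChartAt J o) hbw).trans ?_
    exact (extChartAt J o).right_inv hwt
  obtain ⟨T, hT⟩ := compact_covered_by_mul_left_translates (isCompact_univ (X := G))
    ⟨1, mem_interior_iff_mem_nhds.2 hK1⟩
  have hcover : ⋃ a : T, (fun x : M => (a : G) • x) ⁻¹' C = Set.univ := by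
    rw [Set.eq_univ_iff_forall]
    intro x
    obtain ⟨b, rfl⟩ := MulAction.exists_smul_eq G o x
    obtain ⟨a, ha, hab⟩ := Set.mem_iUnion₂.1 (hT (Set.mem_univ b))
    exact Set.mem_iUnion.2 ⟨⟨a, ha⟩, a * b, hab, mul_smul a b o⟩
  have : Nonempty M := ⟨o⟩
  obtain ⟨a, ha⟩ := nonempty_interior_of_iUnion_of_closed
    (fun a : T => hC.preimage (continuous_const_smul (a : G))) hcover
  have h1 := (Homeomorph.smul (α := M) (a : G)).preimage_interior C
  rw [hCint, Set.preimage_empty] at h1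
  exact Set.nonempty_iff_ne_empty.1 ha h1.symm

end Orbit

end InvMetric

end Surjectivity

/-! ### Invariant metrics with prescribed value at a point -/

section Metric

open InvMetric
open scoped Topology

namespace InvMetric

/-- The unit ball of a positive definite form on a finite-dimensional space is bounded. -/
theorem isVonNBounded_setOf_lt_one {F : Type*} [NormedAddCommGroup F] [NormedSpace ℝ F]
    [FiniteDimensional ℝ F] (b : F →L[ℝ] F →L[ℝ] ℝ) (hpos : ∀ v, v ≠ 0 → 0 < b v v) :
    Bornology.IsVonNBounded ℝ {v : F | b v v < 1} := by
  rw [NormedSpace.isVonNBounded_iff]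
  have hcont : Continuous fun v : F => b v v := by fun_prop
  rcases subsingleton_or_nontrivial F with hF | hF
  · exact (Set.toFinite _).isBounded
  -- compare with the minimum of the form on the unit sphere
  obtain ⟨u, hu, hmin⟩ := (isCompact_sphere (0 : F) 1).exists_isMinOn
    (NormedSpace.sphere_nonempty.2 zero_le_one) hcont.continuousOn
  have hm : 0 < b u u := hpos u (by rintro rfl; simp at hu)
  rw [isBounded_iff_forall_norm_le]
  refine ⟨1 + (b u u)⁻¹, fun v hv => ?_⟩
  rcases eq_or_ne v 0 with rfl | hv0
  · rw [norm_zero]; positivity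
  have hn : 0 < ‖v‖ := norm_pos_iff.2 hv0
  have h1 : b u u ≤ b (‖v‖⁻¹ • v) (‖v‖⁻¹ • v) :=
    hmin (by simp [norm_smul, hn.ne'])
  have h2 : b u u * ‖v‖ ^ 2 ≤ b v v := by
    simp only [map_smul, smul_apply, smul_eq_mul] at h1
    calc b u u * ‖v‖ ^ 2 ≤ ‖v‖⁻¹ * (‖v‖⁻¹ * b v v) * ‖v‖ ^ 2 := by gcongr
      _ = b v v := by field_simp
  have h3 : b v v < 1 := hv
  have h4 : ‖v‖ ^ 2 ≤ (b u u)⁻¹ := by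
    rw [le_inv_comm₀ (by positivity) hm, ← one_div, le_div_iff₀ (by positivity)]
    linarith
  nlinarith [sq_nonneg (‖v‖ - 1)]

section Orbit

variable {F : Type*} [NormedAddCommGroup F] [NormedSpace ℝ F]
  {HM : Type*} [TopologicalSpace HM] {J : ModelWithCorners ℝ F HM}
  {M : Type*} [TopologicalSpace M] [ChartedSpace HM M] {G : Type*} [Group G] [MulAction G M]

variable (J) in
/-- The differential of the action of `a` at `x`, as a map between the model spaces. -/
noncomputable def smulDeriv (a : G) (x : M) : F →L[ℝ] F := mfderiv J J (fun y : M => a • y) x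

theorem smulDeriv_one (x : M) : smulDeriv J (1 : G) x = ContinuousLinearMap.id ℝ F := by
  have h : (fun y : M => (1 : G) • y) = id := by funext y; simp
  unfold smulDeriv
  rw [h, mfderiv_id]
  rfl

variable (J) in
/-- The translate to the point `x` by `a` of a bilinear form on the tangent space at `a⁻¹ • x`. -/
noncomputable def transportForm (b : F →L[ℝ] F →L[ℝ] ℝ) (a : G) (x : M) : F →L[ℝ] F →L[ℝ] ℝ :=
  b.bilinearComp (smulDeriv J a⁻¹ x) (smulDeriv J a⁻¹ x)

theorem transportForm_apply (b : F →L[ℝ] F →L[ℝ] ℝ) (a : G) (x : M) (v w : F) :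
    transportForm J b a x v w = b (smulDeriv J a⁻¹ x v) (smulDeriv J a⁻¹ x w) := rfl

variable {E : Type*} [NormedAddCommGroup E] [NormedSpace ℝ E]
  {HG : Type*} [TopologicalSpace HG] {I : ModelWithCorners ℝ E HG}
  [TopologicalSpace G] [ChartedSpace HG G]

/-- A smooth local section of the orbit map: restricted to a slice, the orbit map is a local
diffeomorphism. -/
theorem exists_local_section [FiniteDimensional ℝ E] [I.Boundaryless] [LieGroup I ∞ G] [T2Space G]
    [CompactSpace G] [FiniteDimensional ℝ F] [J.Boundaryless] [IsManifold J ∞ M] [T2Space M]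
    [ContMDiffSMul I J ∞ G M] [MulAction.IsPretransitive G M] (o : M) :
    ∃ σ : M → G, ContMDiffAt J I ∞ σ o ∧ ∀ᶠ x in 𝓝 o, σ x • o = x := by
  obtain ⟨𝔭, h𝔭⟩ := (LinearMap.ker (orbitLinear I G J o).toLinearMap).exists_isCompl
  obtain ⟨c, hc, hc0, hcd, -⟩ := exists_slice (I := I) (J := J) o 𝔭 h𝔭.symm
  let l : 𝔭 →L[ℝ] F := (orbitLinear I G J o) ∘L 𝔭.subtypeL
  have hd : HasMFDerivAt 𝓘(ℝ, 𝔭) J (fun p => c p • o) 0 l := by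
    refine HasMFDerivAt.comp (g := fun b : G => b • o) (f := c) (0 : 𝔭) ?_ hcd
    rw [hc0]
    exact (mdifferentiable_orbitMap (I := I) (J := J) (G := G) o 1).hasMFDerivAt
  have hbij : Function.Bijective ((orbitLinear I G J o).toLinearMap ∘ₗ 𝔭.subtype) := by
    constructor
    · rw [← LinearMap.ker_eq_bot, LinearMap.ker_comp,
        ← Submodule.disjoint_iff_comap_eq_bot]
      exact h𝔭.disjoint.symm
    · intro v
      obtain ⟨X, rfl⟩ := orbitDeriv_surjective (I := I) (J := J) (G := G) o v
      obtain ⟨Y, hY, Z, hZ, rfl⟩ := Submodule.mem_sup.1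
        (h𝔭.sup_eq_top ▸ Submodule.mem_top : X ∈ _ ⊔ 𝔭)
      refine ⟨⟨Z, hZ⟩, ?_⟩
      have : orbitLinear I G J o Y = 0 := hY
      simp [this]
  let e : 𝔭 ≃L[ℝ] F := (LinearEquiv.ofBijective _ hbij).toContinuousLinearEquiv
  have hf : ContMDiffAt 𝓘(ℝ, 𝔭) J ∞ (fun p => c p • o) 0 :=
    (contMDiff_orbitMap (I := I) (J := J) (G := G) o).contMDiffAt.comp (0 : 𝔭) hc
  obtain ⟨g, hg0, hg, hgr⟩ := exists_local_rightInverse (by simp) hf e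
    (hd.congr_mfderiv (by ext; rfl))
  simp only [hc0, one_smul] at hg0 hg hgr
  refine ⟨fun x => c (g x), ?_, hgr⟩
  refine ContMDiffAt.comp (I' := 𝓘(ℝ, 𝔭)) (g := c) o ?_ hg
  rw [hg0]
  exact hc

variable (I) in
theorem smulDeriv_mul [ContMDiffSMul I J ∞ G M] (a b : G) (x : M) (v : F) :
    smulDeriv J (a * b) x v = smulDeriv J a (b • x) (smulDeriv J b x v) := by
  have h : (fun y : M => (a * b) • y) = (fun y => a • y) ∘ (fun y => b • y) := by
    funext y; simp [mul_smul]
  unfold smulDeriv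
  rw [h]
  exact mfderiv_comp_apply_of_eq (I := J) (I' := J) (I'' := J) x
    (mdifferentiable_smul_left I J a _) (mdifferentiable_smul_left I J b x) rfl v

variable (I) in
theorem smulDeriv_inv_smulDeriv [ContMDiffSMul I J ∞ G M] (a : G) (x : M) (v : F) :
    smulDeriv J a⁻¹ (a • x) (smulDeriv J a x v) = v := by
  rw [← smulDeriv_mul I, inv_mul_cancel, smulDeriv_one]
  rfl

variable (I) in
/-- The translate of an isotropy-invariant form on the tangent space at `o` to a point `a • o`
depends only on that point. -/
theorem transportForm_eq [ContMDiffSMul I J ∞ G M] {o x : M} {b : F →L[ℝ] F →L[ℝ] ℝ}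
    (hb : ∀ h ∈ MulAction.stabilizer G o, ∀ v w, b (smulDeriv J h o v) (smulDeriv J h o w) = b v w)
    {a a' : G} (ha : a • o = x) (ha' : a' • o = x) :
    transportForm J b a x = transportForm J b a' x := by
  have hh : a'⁻¹ * a ∈ MulAction.stabilizer G o := by
    rw [MulAction.mem_stabilizer_iff, mul_smul, ha, ← ha', inv_smul_smul]
  have hx : a⁻¹ • x = o := by rw [← ha, inv_smul_smul]
  have h1 : ∀ v, smulDeriv J a'⁻¹ x v = smulDeriv J (a'⁻¹ * a) o (smulDeriv J a⁻¹ x v) := by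
    intro v
    have h2 := smulDeriv_mul I (J := J) (a'⁻¹ * a) a⁻¹ x v
    rw [hx] at h2
    simpa using h2
  ext v w
  rw [transportForm_apply, transportForm_apply, h1, h1, hb _ hh]

/-- Translating a form along a smooth local section of the orbit map gives a smooth tensor. -/
theorem contMDiffAt_transportForm [LieGroup I ∞ G] [IsManifold J ∞ M] [ContMDiffSMul I J ∞ G M]
    {o x₀ : M} (b : F →L[ℝ] F →L[ℝ] ℝ) {σ : M → G} (hσ : ContMDiffAt J I ∞ σ x₀)
    (hσo : ∀ᶠ x in 𝓝 x₀, σ x • o = x) :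
    ContMDiffAt J (J.prod 𝓘(ℝ, F →L[ℝ] F →L[ℝ] ℝ)) ∞
      (fun x => (Bundle.TotalSpace.mk' (F →L[ℝ] F →L[ℝ] ℝ) x (transportForm (F := F) J b (σ x) x) :
        Bundle.TotalSpace (F →L[ℝ] F →L[ℝ] ℝ)
          (fun x : M => TangentSpace J x →L[ℝ] TangentSpace J x →L[ℝ] ℝ))) x₀ := by
  -- near `x₀` the transported form is the pullback of `b` by the partial differential of `f x` at
  -- `x`, which is smooth in `x` by `ContMDiffAt.mfderiv`
  let f : M → M → M := fun x y => (σ x)⁻¹ • y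
  have hfo : ∀ᶠ x in 𝓝 x₀, f x x = o := by
    filter_upwards [hσo] with x hx
    exact inv_smul_eq_iff.2 hx.symm
  have hf : ContMDiffAt (J.prod J) J ∞ (Function.uncurry f) (x₀, x₀) := by
    have h1 : ContMDiffAt (J.prod J) I ∞ (fun p : M × M => (σ p.1)⁻¹) (x₀, x₀) :=
      (hσ.comp (x₀, x₀) contMDiffAt_fst).inv
    exact h1.smul contMDiffAt_snd
  have hΘ := ContMDiffAt.mfderiv (m := ∞) (n := ∞) f id hf contMDiffAt_id (by simp)
  -- `hΘ` is stated in the bundle coordinates at `o` on the target side; `L'` undoes them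
  let L : F →L[ℝ] F := (trivializationAt F (TangentSpace J) o).continuousLinearMapAt ℝ o
  let L' : F →L[ℝ] F := (trivializationAt F (TangentSpace J) o).symmL ℝ o
  have hL : ∀ v, L' (L v) = v :=
    (trivializationAt F (TangentSpace J) o).symmL_continuousLinearMapAt
      (FiberBundle.mem_baseSet_trivializationAt' o)
  have hcoord : ∀ (x y₀ y : M) (φ : F →L[ℝ] F), y₀ = o → y = o → ∀ v,
      L' (ContinuousLinearMap.inCoordinates F (TangentSpace J) F (TangentSpace J) x₀ x y₀ y φ v) =
        φ ((trivializationAt F (TangentSpace J) x₀).symmL ℝ x v) := by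
    rintro x _ _ φ rfl rfl v
    exact hL _
  let Ψ : (F →L[ℝ] F) → (F →L[ℝ] F →L[ℝ] ℝ) := fun T => b.bilinearComp (L' ∘L T) (L' ∘L T)
  have hΨ : ContDiff ℝ ∞ Ψ := by
    have h1 : ContDiff ℝ ∞ (fun T : F →L[ℝ] F => L' ∘L T) := contDiff_const.clm_comp contDiff_id
    exact ((ContinuousLinearMap.compL ℝ F F ℝ).flip.contDiff.comp h1).clm_comp
      (contDiff_const.clm_comp h1)
  rw [contMDiffAt_hom_bundle]
  refine ⟨contMDiffAt_id, ?_⟩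
  have hmain : ContMDiffAt J 𝓘(ℝ, F →L[ℝ] F →L[ℝ] ℝ) ∞ (fun x => Ψ (inTangentCoordinates J J id
      (fun x => f x (id x)) (fun x => mfderiv J J (f x) (id x)) x₀ x)) x₀ :=
    hΨ.contMDiff.contMDiffAt.comp x₀ hΘ
  refine hmain.congr_of_eventuallyEq ?_
  have hbase : ∀ᶠ x in 𝓝 x₀, x ∈ (trivializationAt F (TangentSpace J) x₀).baseSet :=
    (trivializationAt F (TangentSpace J) x₀).open_baseSet.mem_nhds
      (FiberBundle.mem_baseSet_trivializationAt' x₀)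
  filter_upwards [hfo, hbase] with x hx hxb
  ext v w
  have h1 := hcoord x (f x₀ x₀) (f x x) (mfderiv J J (f x) x) hfo.self_of_nhds hx
  refine (inCoordinates_apply_eq₂ (F₁ := F) (E₁ := TangentSpace J) (F₂ := F)
    (E₂ := TangentSpace J) (F₃ := ℝ) (E₃ := Bundle.Trivial M ℝ) hxb hxb (Set.mem_univ x)).trans ?_
  have htriv : ∀ z : ℝ, (trivializationAt ℝ (Bundle.Trivial M ℝ) x₀).linearMapAt ℝ x z = z := by
    intro z
    simp
  refine (htriv _).trans ?_
  rw [← Bundle.Trivialization.symmL_apply (R := ℝ) _ hxb,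
    ← Bundle.Trivialization.symmL_apply (R := ℝ) _ hxb]
  exact (congrArg₂ (fun v w => b v w) (h1 v) (h1 w)).symm

/-- An isotropy-invariant inner product on the tangent space at `o` extends to an invariant
Riemannian metric. -/
theorem exists_invariantMetric [FiniteDimensional ℝ E] [I.Boundaryless] [LieGroup I ∞ G]
    [T2Space G] [CompactSpace G] [FiniteDimensional ℝ F] [J.Boundaryless] [IsManifold J ∞ M]
    [T2Space M] [ContMDiffSMul I J ∞ G M] [MulAction.IsPretransitive G M] (o : M)
    (b : F →L[ℝ] F →L[ℝ] ℝ) (hsymm : ∀ v w, b v w = b w v) (hpos : ∀ v, v ≠ 0 → 0 < b v v)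
    (hb : ∀ h ∈ MulAction.stabilizer G o, ∀ v w,
      b (smulDeriv J h o v) (smulDeriv J h o w) = b v w) :
    ∃ g : SmoothMetric J M, IsInvariantMetric J G g ∧ ∀ v w : TangentSpace J o,
      g.inner o v w = b v w := by
  have hcs : ContinuousSMul G M := ContMDiffSMul.continuousSMul (I := I) (I' := J) ∞
  -- `α` need not be continuous: the transported form does not depend on the choice of `α x`
  choose α hα using MulAction.exists_smul_eq G o
  have hposx : ∀ x (v : F), v ≠ 0 → 0 < transportForm J b (α x) x v v := by
    intro x v hv
    rw [transportForm_apply]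
    refine hpos _ fun h => hv ?_
    have h1 := smulDeriv_inv_smulDeriv I (J := J) (α x)⁻¹ x v
    rw [h, map_zero] at h1
    exact h1.symm
  have htransport : ∀ (a : G) (x : M) (v w : F), transportForm J b (α (a • x)) (a • x)
      (smulDeriv J a x v) (smulDeriv J a x w) = transportForm J b (α x) x v w := by
    intro a x v w
    have h1 : (a * α x) • o = a • x := by rw [mul_smul, hα]
    rw [transportForm_eq I hb (hα (a • x)) h1, transportForm_apply, transportForm_apply]
    have h2 : ∀ v : F, smulDeriv J (a * α x)⁻¹ (a • x) (smulDeriv J a x v) =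
        smulDeriv J (α x)⁻¹ x v := by
      intro v
      rw [mul_inv_rev, smulDeriv_mul I, smulDeriv_inv_smulDeriv I, inv_smul_smul]
    rw [h2, h2]
  have hbase : ∀ v w : F, transportForm J b (α o) o v w = b v w := by
    intro v w
    rw [transportForm_eq I hb (hα o) (one_smul G o), transportForm_apply, inv_one, smulDeriv_one]
    rfl
  refine ⟨⟨fun x => transportForm (F := F) J b (α x) x, fun x v w => hsymm _ _,
    fun x v hv => hposx x v hv,
    fun x => isVonNBounded_setOf_lt_one (F := F) (transportForm J b (α x) x) (hposx x), ?_⟩,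
    ?_, ?_⟩
  · intro x₀
    obtain ⟨σ₀, hσ₀, hσ₀o⟩ := exists_local_section (I := I) (J := J) (G := G) o
    have hx₀ : (α x₀)⁻¹ • x₀ = o := by rw [inv_smul_eq_iff, hα]
    -- the local section at `o`, moved to `x₀`
    let σ : M → G := fun x => α x₀ * σ₀ ((α x₀)⁻¹ • x)
    have hσ : ContMDiffAt J I ∞ σ x₀ := by
      refine contMDiffAt_const.mul (ContMDiffAt.comp (g := σ₀) (I' := J) x₀ ?_
        (ContMDiffSMul.contMDiff_const_smul (I := I) (I' := J) (n := ∞) (α x₀)⁻¹).contMDiffAt)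
      rw [hx₀]
      exact hσ₀
    have hσo : ∀ᶠ x in 𝓝 x₀, σ x • o = x := by
      have h1 : Filter.Tendsto (fun x : M => (α x₀)⁻¹ • x) (𝓝 x₀) (𝓝 o) := by
        have h2 := (continuous_const_smul (T := M) (α x₀)⁻¹).tendsto x₀
        rwa [hx₀] at h2
      filter_upwards [h1.eventually hσ₀o] with x hx
      rw [mul_smul, hx, smul_inv_smul]
    refine (contMDiffAt_transportForm b hσ hσo).congr_of_eventuallyEq ?_
    filter_upwards [hσo] with x hx
    rw [transportForm_eq I hb (hα x) hx]
  · intro a x v w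
    exact htransport a x v w
  · exact hbase

end Orbit

end InvMetric

end Metric

/-! ### Metric operators -/

section MetricOperator

open InvMetric

namespace InvMetric

/-- The isotropy group acts by isometries on the tangent space. -/
theorem IsInvariantMetric.inner_stabilizer
    {F : Type*} [NormedAddCommGroup F] [NormedSpace ℝ F]
    {HM : Type*} [TopologicalSpace HM] {J : ModelWithCorners ℝ F HM}
    {M : Type*} [TopologicalSpace M] [ChartedSpace HM M] [IsManifold J ∞ M]
    {G : Type*} [Group G] [MulAction G M] {g : SmoothMetric J M}
    (hg : IsInvariantMetric J G g) {o : M} {h : G} (hh : h ∈ MulAction.stabilizer G o)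
    (v w : TangentSpace J o) :
    g.inner o (smulDeriv J h o v : F) (smulDeriv J h o w : F) = g.inner o v w := by
  have key : ∀ y, y = o → ∀ v w : F, g.inner y v w = g.inner o v w := by
    rintro _ rfl _ _
    rfl
  exact (key (h • o) hh _ _).symm.trans (hg h o v w)

variable {E : Type*} [NormedAddCommGroup E] [NormedSpace ℝ E]
  {HG : Type*} [TopologicalSpace HG] {I : ModelWithCorners ℝ E HG}
  {G : Type*} [TopologicalSpace G] [ChartedSpace HG G] [Group G] [LieGroup I ∞ G]
  {F : Type*} [NormedAddCommGroup F] [NormedSpace ℝ F]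
  {HM : Type*} [TopologicalSpace HM] {J : ModelWithCorners ℝ F HM}
  {M : Type*} [TopologicalSpace M] [ChartedSpace HM M]
  [MulAction G M] [ContMDiffSMul I J ∞ G M]

/-- The differential of the orbit map intertwines the adjoint and the isotropy representation. -/
theorem orbitDeriv_AdH (o : M) (h : MulAction.stabilizer G o) (X : GroupLieAlgebra I G) :
    orbitDeriv I J (G := G) o (AdH I o h X) =
      smulDeriv J (h : G) o (orbitDeriv I J (G := G) o X) := by
  have hc : (fun b : G => b • o) ∘ (fun b : G => (h : G) * b * (h : G)⁻¹) =
      (fun x : M => (h : G) • x) ∘ (fun b : G => b • o) := by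
    funext b
    have : (h : G)⁻¹ • o = o := by rw [inv_smul_eq_iff, MulAction.mem_stabilizer_iff.1 h.2]
    simp [mul_smul, this]
  have hd : MDifferentiableAt I I (fun b : G => (h : G) * b * (h : G)⁻¹) 1 :=
    (((contMDiff_mul_left (I := I) (n := ∞) (a := (h : G))).mul
      (contMDiff_const (c := (h : G)⁻¹))).mdifferentiable (by simp)) 1
  have h1 := mfderiv_comp_apply_of_eq (I := I) (I' := I) (I'' := J) (x := (1 : G))
    (mdifferentiable_orbitMap (I := I) (J := J) o 1) hd (by simp) X
  have h2 := mfderiv_comp_apply_of_eq (I := I) (I' := J) (I'' := J) (x := (1 : G))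
    (mdifferentiable_smul_left I J (h : G) o) (mdifferentiable_orbitMap (I := I) (J := J) o 1)
    (one_smul G o) X
  rw [hc] at h1
  exact h1.symm.trans h2

/-- The pullback of the metric at `o` by the differential of the orbit map. -/
noncomputable def pullbackForm [IsManifold J ∞ M] (I : ModelWithCorners ℝ E HG) (G : Type*)
    [TopologicalSpace G] [ChartedSpace HG G] [Group G] [MulAction G M]
    (g : SmoothMetric J M) (o : M) : LinearMap.BilinForm ℝ (GroupLieAlgebra I G) :=
  LinearMap.mk₂ ℝ (fun X Y => g.inner o (orbitDeriv I J (G := G) o X) (orbitDeriv I J (G := G) o Y))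
    (by simp) (by simp) (by simp) (by simp)

section

variable [FiniteDimensional ℝ E] [I.Boundaryless] [T2Space G] [J.Boundaryless] [T2Space M]
  [IsManifold J ∞ M]

theorem orbitDeriv_ne_zero (o : M) {B : LinearMap.BilinForm ℝ (GroupLieAlgebra I G)}
    (hB : IsInvariantInner I B) {X : GroupLieAlgebra I G}
    (hX : X ∈ complement I B (MulAction.stabilizer G o)) (h0 : X ≠ 0) :
    orbitDeriv I J (G := G) o X ≠ 0 := fun h =>
  (hB.pos X h0).ne' (hX X ((mem_lieAlgebraOf_stabilizer o X).2 h))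

/-- The orthogonal complement of the isotropy algebra is isomorphic to the tangent space at `o`. -/
theorem orbitDeriv_complement_bijective [CompactSpace G] [FiniteDimensional ℝ F]
    [MulAction.IsPretransitive G M] (o : M) {B : LinearMap.BilinForm ℝ (GroupLieAlgebra I G)}
    (hB : IsInvariantInner I B) : Function.Bijective
      ((orbitDeriv I J (G := G) o).toLinearMap ∘ₗ
        (complement I B (MulAction.stabilizer G o)).subtype) := by
  have : FiniteDimensional ℝ (GroupLieAlgebra I G) := inferInstanceAs (FiniteDimensional ℝ E)
  constructor
  · rw [injective_iff_map_eq_zero]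
    intro X hX
    by_contra h0
    exact orbitDeriv_ne_zero (J := J) o hB X.2 (by simpa using h0) hX
  · intro v
    obtain ⟨X, rfl⟩ : ∃ X : GroupLieAlgebra I G, orbitDeriv I J (G := G) o X = v :=
      orbitDeriv_surjective (I := I) (J := J) (G := G) o v
    let k := LinearMap.ker (orbitDeriv I J (G := G) o).toLinearMap
    -- subtract the orthogonal projection to the kernel
    obtain ⟨f, hf⟩ := exists_linearMap_of_pos (b := B.compl₁₂ k.subtype k.subtype)
      (fun X hX => hB.pos X (by simpa using hX)) (B.compl₁₂ LinearMap.id k.subtype)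
    refine ⟨⟨X - f X, fun Y hY => ?_⟩, ?_⟩
    · have h1 : B (f X) Y = B X Y := hf X ⟨Y, (mem_lieAlgebraOf_stabilizer o Y).1 hY⟩
      rw [map_sub, LinearMap.sub_apply, h1, sub_self]
    · have h1 : orbitDeriv I J (G := G) o (f X : GroupLieAlgebra I G) = 0 := (f X).2
      change orbitDeriv I J (G := G) o (X - f X) = orbitDeriv I J (G := G) o X
      rw [map_sub, h1, sub_zero]

end

end InvMetric

end MetricOperator

open InvMetric

theorem theorem2p12
    {E : Type*} [NormedAddCommGroup E] [NormedSpace ℝ E] [FiniteDimensional ℝ E]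
    {HG : Type*} [TopologicalSpace HG] (I : ModelWithCorners ℝ E HG) [I.Boundaryless]
    {G : Type*} [TopologicalSpace G] [T2Space G] [CompactSpace G] [ChartedSpace HG G]
    [Group G] [LieGroup I ∞ G]
    {F : Type*} [NormedAddCommGroup F] [NormedSpace ℝ F] [FiniteDimensional ℝ F]
    {HM : Type*} [TopologicalSpace HM] (J : ModelWithCorners ℝ F HM) [J.Boundaryless]
    {M : Type*} [TopologicalSpace M] [T2Space M] [ChartedSpace HM M] [IsManifold J ∞ M]
    [MulAction G M] [ContMDiffSMul I J ∞ G M] [MulAction.IsPretransitive G M] (o : M)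
    (B : LinearMap.BilinForm ℝ (GroupLieAlgebra I G)) (hB : IsInvariantInner I B)
    (𝔪 : Submodule ℝ (GroupLieAlgebra I G))
    (h𝔪 : 𝔪 = complement I B (MulAction.stabilizer G o))
    {s : ℕ} (W : Fin s → Subrepresentation (AdH I (G := G) o)) (hW : IsDecomposition B 𝔪 W)
    {S : ℕ} {t : Fin S → ℕ} [∀ i, NeZero (t i)] (e : (Σ i, Fin (t i)) ≃ Fin s)
    (he : IsIsotypical W e) (𝓑 : AdaptedBasis B 𝔪 W e) :
    (∀ g : SmoothMetric J M, IsInvariantMetric J G g →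
      (∃! A : 𝔪 →ₗ[ℝ] 𝔪, IsMetricOperator I J o B 𝔪 g A) ∧
      ∀ A : 𝔪 →ₗ[ℝ] 𝔪, IsMetricOperator I J o B 𝔪 g A →
        ∃ (μ : ∀ i, Fin (t i) → ℝ)
          (N : ∀ i, Fin (t i) → Fin (t i) → Matrix (Fin (𝓑.d i)) (Fin (𝓑.d i)) ℝ),
          (∀ i l, 0 < μ i l) ∧
          (∀ i l k, k < l → ∃ τ, IsScalarBlock (N i l k) τ) ∧
          LinearMap.toMatrix 𝓑.basis 𝓑.basis A =
            Matrix.blockDiagonal' fun i => isotypicalBlock (μ i) (N i)) ∧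
    (∀ (μ : ∀ i, Fin (t i) → ℝ)
      (N : ∀ i, Fin (t i) → Fin (t i) → Matrix (Fin (𝓑.d i)) (Fin (𝓑.d i)) ℝ),
      (∀ i l, 0 < μ i l) →
      (∀ i l k, k < l → ∃ τ, IsScalarBlock (N i l k) τ) →
      (∀ i l k, k < l → ∀ h : MulAction.stabilizer G o,
        Commute (N i l k) (LinearMap.toMatrix (𝓑.first i) (𝓑.first i)
          ((W (e ⟨i, 0⟩)).toRepresentation h))) →
      (Matrix.blockDiagonal' fun i => isotypicalBlock (μ i) (N i)).PosDef →
      ∃ g : SmoothMetric J M, IsInvariantMetric J G g ∧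
        IsMetricOperator I J o B 𝔪 g
          (Matrix.toLin 𝓑.basis 𝓑.basis
            (Matrix.blockDiagonal' fun i => isotypicalBlock (μ i) (N i)))) := by
  have : FiniteDimensional ℝ (GroupLieAlgebra I G) := inferInstanceAs (FiniteDimensional ℝ E)
  have hinv : ∀ (h : MulAction.stabilizer G o) X Y, B (AdH I o h X) (AdH I o h Y) = B X Y :=
    fun h X Y => hB.invariant h X Y
  constructor
  · intro g hg
    let Q := pullbackForm I G g o
    constructor
    -- existence and uniqueness: `B` is nondegenerate on `𝔪`
    · obtain ⟨A, hA⟩ := exists_linearMap_of_pos (b := B.compl₁₂ 𝔪.subtype 𝔪.subtype)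
        (fun X hX => hB.pos X (by simpa using hX)) (Q.compl₁₂ 𝔪.subtype 𝔪.subtype)
      refine ⟨A, fun X Y => hA X Y, fun A' hA' => ?_⟩
      ext1 X
      apply injective_of_pos (b := B.compl₁₂ 𝔪.subtype 𝔪.subtype)
        (fun X hX => hB.pos X (by simpa using hX))
      ext Y
      exact (hA' X Y).trans (hA X Y).symm
    · intro A hA
      refine 𝓑.exists_toMatrix_eq hW he hB.pos hinv Q (fun h X Y => ?_) (fun X Y => g.symm _ _ _)
        (fun X hX h0 => g.pos _ _ ?_) A hA
      · change g.inner o (orbitDeriv I J o (AdH I o h X)) (orbitDeriv I J o (AdH I o h Y)) = _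
        rw [orbitDeriv_AdH, orbitDeriv_AdH]
        exact hg.inner_stabilizer h.2 _ _
      · rw [h𝔪] at hX
        exact orbitDeriv_ne_zero o hB hX h0
  · intro μ N _ _ hN hD
    set D := Matrix.blockDiagonal' fun i => isotypicalBlock (μ i) (N i) with hDdef
    let A := Matrix.toLin 𝓑.basis 𝓑.basis D
    let ψ : 𝔪 →ₗ[ℝ] F := (orbitDeriv I J (G := G) o).toLinearMap ∘ₗ 𝔪.subtype
    have hψ : Function.Bijective ψ := by
      subst h𝔪
      exact orbitDeriv_complement_bijective o hB
    -- the inner product `B (A X) Y`, carried over to the tangent space at `o`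
    let L : F ≃ₗ[ℝ] 𝔪 := (LinearEquiv.ofBijective ψ hψ).symm
    have hL : ∀ X : 𝔪, L (ψ X) = X := fun X => (LinearEquiv.ofBijective ψ hψ).symm_apply_apply X
    let b₀ : F →ₗ[ℝ] F →ₗ[ℝ] ℝ :=
      B.compl₁₂ (𝔪.subtype ∘ₗ A ∘ₗ L.toLinearMap) (𝔪.subtype ∘ₗ L.toLinearMap)
    let b : F →L[ℝ] F →L[ℝ] ℝ :=
      (LinearMap.toContinuousLinearMap.toLinearMap ∘ₗ b₀).toContinuousLinearMap
    have hb : ∀ v w, b v w = B (A (L v)) (L w) := fun v w => rfl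
    obtain ⟨g, hg, hgo⟩ := exists_invariantMetric (I := I) (J := J) (G := G) o b
      (fun v w => by rw [hb, hb]; exact 𝓑.inner_toLin_comm hW hD _ _)
      (fun v hv => by rw [hb]; exact 𝓑.inner_toLin_pos hW hD (by simpa using hv)) (by
        intro h hh
        have hLh : ∀ v : F, L (smulDeriv J h o v) =
            (AdH I o ⟨h, hh⟩).restrict (hW.apply_mem ⟨h, hh⟩) (L v) := by
          intro v
          obtain ⟨X, rfl⟩ := hψ.2 v
          rw [hL]
          refine Eq.trans ?_ (hL _)
          exact congrArg L (orbitDeriv_AdH (I := I) (J := J) o ⟨h, hh⟩ X).symm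
        intro v w
        rw [hb, hb, hLh, hLh]
        rw [𝓑.toLin_comm hW hB.symm hinv μ N hN ⟨h, hh⟩ (L v)]
        exact hinv _ _ _)
    refine ⟨g, hg, fun X Y => ?_⟩
    rw [hgo]
    change _ = b (ψ X) (ψ Y)
    rw [hb, hL, hL]
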